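/- **Setting.** Let $\mathbb K$ be a field and let $A=\mathbb K[X_1][X_2;\sigma_2,\delta_2]\cdots[X_N;\sigma_N,\delta_N]$ be an iterated Ore extension ($\sigma_i$ a $\mathbb K$-algebra automorphism and $\delta_i$ a $\mathbb K$-linear left $\sigma_i$-derivation of $A_{i-1}=\mathbb K\langle X_1,\dots,X_{i-1}\rangle$, with $X_ia=\sigma_i(a)X_i+\delta_i(a)$) such that: - $\sigma_i(X_l)=\lambda_{i,l}X_l$ for $1\le l<i$, where $(\lambda_{i,l})\in M_N(\mathbb K^*)$ satisfies $\lambda_{i,l}=\lambda_{l,i}^{-1}$ for all $i,l$; - for $2\le i\le N$ there is $q_i\in\mathbb K^*$, $q_i\ne1$, with $\delta_i\sigma_i=q_i\sigma_i\delta_i$; - for $2\le i\le N$, $\delta_i$ extends to a locally nilpotent, iterative higher $q_i$-skew $\sigma_i$-derivation on $A_{i-1}$: there are $\mathbb K$-linear maps $d_{i,n}$ ($n\ge0$) on $A_{i-1}$ with $d_{i,0}=\mathrm{id}$, $d_{i,1}=\delta_i$, $d_{i,n}(rs)=\sum_{k=0}^n\sigma_i^{n-k}d_{i,k}(r)\,d_{i,n-k}(s)$,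 $d_{i,n}\sigma_i=q_i^n\sigma_id_{i,n}$, $d_{i,n}d_{i,m}=\binom{n+m}{m}_{q_i}d_{i,n+m}$ (Gaussian binomials), and for each $r$, $d_{i,n}(r)=0$ for all large $n$. Moreover $\sigma_l d_{i,n}=\lambda_{l,i}^n d_{i,n}\sigma_l$ on $A_{i-1}$ for $n\ge 0$ and $i<l\le N$. Fix such $d_{i,n}$. **Deleting derivations.** Put $X_i^{(N+1)}=X_i$. For $j=N,\dots,2$ define in $\mathrm{Frac}(A)$: $X^{(j)}_i=X^{(j+1)}_i$ for $i\ge j$, and for $i<j$ $$X_i^{(j)}=\sum_{n\ge0}q_j^{n(n+1)/2}(q_j-1)^{-n}\,d_{j,n}\sigma_j^{-n}\bigl(X_i^{(j+1)}\bigr)\bigl(X_j^{(j+1)}\bigr)^{-n},$$ where $d_{j,n}\sigma_j^{-n}(X_i^{(j+1)})$ is the image of $d_{j,n}\sigma_j^{-n}(X_i)$ under the algebra homomorphism $A_{j-1}\to\mathrm{Frac}(A)$ with $X_l\mapsto X_l^{(j+1)}$. Let $A^{(j)}$ be the subalgebra generated by $X^{(j)}_1,\dots,X^{(j)}_N$;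 put $A'=A^{(2)}$ and $T_i=X_i^{(2)}$. For a completely prime ideal $P$ of $A^{(j+1)}$, with $x_j=X_j^{(j+1)}$, put $\psi_j(P)=P\{x_j^n\}^{-1}\cap A^{(j)}$ if $x_j\notin P$, and $\psi_j(P)=g_j^{-1}(P/\langle x_j\rangle)$ if $x_j\in P$, where $g_j:A^{(j)}\to A^{(j+1)}/\langle x_j\rangle$ is the homomorphism with $X_i^{(j)}\mapsto X_i^{(j+1)}+\langle x_j\rangle$. Let $\psi=\psi_2\circ\cdots\circ\psi_N$. For $w\subseteq\{1,\dots,N\}$, let $\mathrm{C.Spec}_w(A)$ be the set of completely prime ideals $P$ of $A$ such that $T_i\in\psi(P)\iff i\in w$. Let $P\in\mathrm{C.Spec}_w(A)$, $B=A/P$, $B'=A'/\psi(P)$, let $t_i$ be the image of $T_i$ in $B'$, and let $\Sigma$ be the multiplicatively closed set (containing $1$) of $B'$ generated by the $t_i$ with $i\notin w$. In $\mathrm{Frac}(B)$ let $\bar X^{(N+1)}_i$ be the image of $X_i$. For $j=N,\dots,2$: if $\bar X_j^{(j+1)}=0$, put $\bar X_i^{(j)}=\bar X_i^{(j+1)}$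 for all $i$; otherwise define $\bar X^{(j)}_i$ from the $\bar X_l^{(j+1)}$ by the same formulas as above (with $\mathrm{Frac}(B)$ in place of $\mathrm{Frac}(A)$). Let $B^{(j)}$ be the subalgebra of $\mathrm{Frac}(B)$ generated by the $\bar X^{(j)}_i$. Put $\Sigma_2=\langle \bar X_i^{(2)}: i\notin w\rangle$ (multiplicatively closed set generated), $\Sigma_{j+1}=B^{(j+1)}\cap\Sigma_j$ for $2\le j\le N$, and $\Gamma=\Sigma_{N+1}\subseteq B$. **Proposition.** Let $(\phi',V)$ be an irreducible representation of $B'$ such that for each $e\in\Sigma$ there are $\xi_e\in\mathbb K^*$ and an integer $\ell_e>1$ with $\phi'(e)^{\ell_e}=\xi_e\,\mathrm{Id}_V$. Then $B'$ embeds in $\mathrm{Frac}(B)$ by an algebra homomorphism with $t_i\mapsto\bar X_i^{(2)}$; and, identifying $B'$ with its image, $B'\Sigma^{-1}=B\Gamma^{-1}$ in $\mathrm{Frac}(B)$, and: 1. For every $b\in B$ there are $b'\in B'$ and $e\in\Sigma$ with $b=b'e^{-1}\in B'\Sigma^{-1}$, and there is a well-defined irreducible representation $\phi:B\to\mathrm{End}_{\mathbb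 K}(V)$ of $B$ on the same space $V$ given by $\phi(b)=\xi^{-1}\phi'(b')\phi'(e)^{\ell-1}$ for all such $b',e$ and all $\xi\in\mathbb K^*$, $\ell>1$ with $\phi'(e)^\ell=\xi\,\mathrm{Id}_V$. 2. For each $g\in\Gamma$ there are $\xi'\in\mathbb K^*$ and an integer $\ell'>1$ with $\phi(g)^{\ell'}=\xi'\,\mathrm{Id}_V$. -/

import Mathlib

universe u v

namespace DeletingDerivations

noncomputable section

/-! ### Generalities on algebras over a field -/

/-- The Gaussian binomial coefficient `(n choose k)_q`, an integer polynomial in `q` evaluated at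
an element `q` of `K` (which may be a root of unity), given by the `q`-Pascal rule. -/
def gaussBinom {K : Type*} [Field K] (q : K) : ℕ → ℕ → K
  | _, 0 => 1
  | 0, _ + 1 => 0
  | n + 1, k + 1 => gaussBinom q n k + q ^ (k + 1) * gaussBinom q n (k + 1)

/-- `S = R[x; σ, δ]` is an Ore extension inside an ambient algebra: `R` is a subalgebra of `S`,
`x ∈ S`, `δ` is a left `σ`-derivation of `R`, `x r = σ(r) x + δ(r)` for `r ∈ R`, and `S` is a free
left `R`-module with basis `1, x, x², …`. -/
structure IsOreExtension {K : Type*} [Field K] {A : Type*} [Ring A] [Algebra K A]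
    (R S : Subalgebra K A) (x : A) (σ : R ≃ₐ[K] R) (δ : R →ₗ[K] R) : Prop where
  le : R ≤ S
  mem : x ∈ S
  derivation : ∀ a b : R, δ (a * b) = σ a * δ b + δ a * b
  comm : ∀ a : R, x * (a : A) = (σ a : A) * x + (δ a : A)
  basis : ∀ s ∈ S, ∃! p : ℕ →₀ R, s = p.sum fun n r => (r : A) * x ^ n

/-- `{d n}` is a locally nilpotent, iterative higher `q`-skew `σ`-derivation on `R` that extends
`δ`. (Local nilpotence: every `r` is killed by all `d n` with `n` large.) -/
structure IsHigherSkewDerivation {K : Type*} [Field K] {R : Type*} [Ring R] [Algebra K R]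
    (q : K) (σ : R ≃ₐ[K] R) (δ : R →ₗ[K] R) (d : ℕ → R →ₗ[K] R) : Prop where
  zero : ∀ r, d 0 r = r
  one : ∀ r, d 1 r = δ r
  mul : ∀ n r s, d n (r * s) =
    ∑ i ∈ Finset.range (n + 1), (σ ^ (n - i)) (d i r) * d (n - i) s
  skew : ∀ n r, d n (σ r) = q ^ n • σ (d n r)
  locallyNilpotent : ∀ r, ∃ m, ∀ n, m ≤ n → d n r = 0
  iterative : ∀ n m r, d n (d m r) = gaussBinom q (n + m) m • d (n + m) r

/-- `ι : A → F` exhibits the division ring `F` as the division ring of fractions of `A`. -/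
def IsDivisionRingOfFractions {K : Type*} [Field K] {A F : Type*} [Ring A] [Algebra K A]
    [DivisionRing F] [Algebra K F] (ι : A →ₐ[K] F) : Prop :=
  Function.Injective ι ∧ ∀ f : F, ∃ a s : A, s ≠ 0 ∧ f = ι a * (ι s)⁻¹

/-- Completely prime two-sided ideals. -/
def IsCompletelyPrime {A : Type*} [Ring A] (P : TwoSidedIdeal A) : Prop :=
  P ≠ ⊤ ∧ ∀ a b : A, a * b ∈ P → a ∈ P ∨ b ∈ P

/-- The quotient algebra `A / P`. -/
abbrev Quo {A : Type*} [Ring A] (P : TwoSidedIdeal A) : Type _ := P.ringCon.Quotient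

/-- The canonical surjection `A → A / P`. -/
def quoMk (K : Type*) [Field K] {A : Type*} [Ring A] [Algebra K A] (P : TwoSidedIdeal A) :
    A →ₐ[K] Quo P := RingCon.mkₐ K P.ringCon

/-- The representation `φ : R → End_K(V)` is irreducible: `V ≠ 0` and the only invariant
subspaces are `0` and `V`. -/
def IsIrreducibleRep {K : Type*} [Field K] {R : Type*} [Ring R] [Algebra K R]
    {V : Type*} [AddCommGroup V] [Module K V] (φ : R →ₐ[K] Module.End K V) : Prop :=
  Nontrivial V ∧
    ∀ W : Submodule K V, (∀ r : R, ∀ v ∈ W, φ r v ∈ W) → W = ⊥ ∨ W = ⊤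

/-! ### Quantum nilpotent algebras -/

/-- The subalgebra `A_{i-1}` generated by `X_1, …, X_{i-1}`. -/
def lower (K : Type*) [Field K] {A : Type*} [Ring A] [Algebra K A] (X : ℕ → A) (i : ℕ) :
    Subalgebra K A := Algebra.adjoin K (X '' Set.Ico 1 i)

/-- `X_l`, for `1 ≤ l < i`, as an element of `A_{i-1}`. -/
def lowerGen (K : Type*) [Field K] {A : Type*} [Ring A] [Algebra K A] (X : ℕ → A) {i : ℕ}
    (l : Set.Ico 1 i) : lower K X i :=
  ⟨X l, Algebra.subset_adjoin (Set.mem_image_of_mem X l.2)⟩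

theorem lower_mono (K : Type*) [Field K] {A : Type*} [Ring A] [Algebra K A] (X : ℕ → A)
    {i l : ℕ} (h : i ≤ l) : lower K X i ≤ lower K X l :=
  Algebra.adjoin_mono (Set.image_mono (Set.Ico_subset_Ico_right h))

/-- A quantum nilpotent algebra `A = K[X_1][X_2; σ_2, δ_2] … [X_N; σ_N, δ_N]`, with its
presentation and the higher skew-derivations `d_{i,n}`. Only the data with indices between `1` and
`N` matters; `σ_1` and `δ_1` live on `A_0 = K`, so they are the identity and zero, which makes
the first extension the polynomial algebra `K[X_1]`. -/
structure QuantumNilpotentAlgebra (K : Type u) [Field K] (N : ℕ) (A : Type v) [Ring A]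
    [Algebra K A] where
  X : ℕ → A
  σ : ∀ i, lower K X i ≃ₐ[K] lower K X i
  δ : ∀ i, lower K X i →ₗ[K] lower K X i
  lam : ℕ → ℕ → K
  q : ℕ → K
  d : ∀ i, ℕ → lower K X i →ₗ[K] lower K X i
  nontrivial : Nontrivial A
  lower_eq_top : lower K X (N + 1) = ⊤
  ore : ∀ i ∈ Set.Icc 1 N, IsOreExtension (lower K X i) (lower K X (i + 1)) (X i) (σ i) (δ i)
  σ_gen : ∀ i ∈ Set.Icc 2 N, ∀ l : Set.Ico 1 i,
    σ i (lowerGen K X l) = lam i l • lowerGen K X l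
  lam_ne_zero : ∀ i ∈ Set.Icc 1 N, ∀ l ∈ Set.Icc 1 N, lam i l ≠ 0
  lam_inv : ∀ i ∈ Set.Icc 1 N, ∀ l ∈ Set.Icc 1 N, lam i l = (lam l i)⁻¹
  q_ne_zero : ∀ i ∈ Set.Icc 2 N, q i ≠ 0
  q_ne_one : ∀ i ∈ Set.Icc 2 N, q i ≠ 1
  skew : ∀ i ∈ Set.Icc 2 N, ∀ a, δ i (σ i a) = q i • σ i (δ i a)
  higher : ∀ i ∈ Set.Icc 2 N, IsHigherSkewDerivation (q i) (σ i) (δ i) (d i)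
  /-- `σ_l ∘ d_{i,n} = λ_{l,i}^n d_{i,n} ∘ σ_l` on `A_{i-1}`; here `a'` is `σ_l(a)`, which lies in
  `A_{i-1}` again because `σ_l` multiplies each generator by a scalar. -/
  σ_d : ∀ i ∈ Set.Icc 2 N, ∀ l ∈ Set.Icc 2 N, ∀ h : i < l, ∀ (n : ℕ) (a a' : lower K X i),
    σ l (Subalgebra.inclusion (lower_mono K X h.le) a) =
      Subalgebra.inclusion (lower_mono K X h.le) a' →
    σ l (Subalgebra.inclusion (lower_mono K X h.le) (d i n a)) =
      lam l i ^ n • Subalgebra.inclusion (lower_mono K X h.le) (d i n a')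

/-- The subalgebra generated by the entries `x_1, …, x_N` of a sequence in `D`. -/
def alg (K : Type*) [Field K] (N : ℕ) {D : Type*} [Ring D] [Algebra K D] (x : ℕ → D) :
    Subalgebra K D := Algebra.adjoin K (x '' Set.Icc 1 N)

/-- The generator `x_i` as an element of `alg K N x`. -/
def gen (K : Type*) [Field K] {N : ℕ} {D : Type*} [Ring D] [Algebra K D] (x : ℕ → D)
    (i : Set.Icc 1 N) : alg K N x :=
  ⟨x i, Algebra.subset_adjoin (Set.mem_image_of_mem x i.2)⟩

namespace QuantumNilpotentAlgebra

variable {K : Type u} [Field K] {N : ℕ} {A : Type v} [Ring A] [Algebra K A]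
  (H : QuantumNilpotentAlgebra K N A)

/-! ### The deleting derivations algorithm

The algorithm is written for a sequence `(x_1, …, x_N)` in a `K`-division algebra `D`. It is used
for `D = Frac(A)`, starting from the generators of `A`, and for `D = Frac(A/P)`, starting from
their images in `A/P`. -/

section Algorithm

variable {D : Type*} [DivisionRing D] [Algebra K D]

open Classical in
/-- The algebra homomorphism `A_{j-1} → D` with `X_l ↦ x_l` for `l < j`, through which an
element of `A_{j-1}`, such as `d_{j,n}(X_i)`, is read as an element of `D` (and then denoted
`d_{j,n}(x_i)`). It is unique; if there were none, the value is the zero map. -/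
def transport (x : ℕ → D) (j : ℕ) : lower K H.X j → D :=
  if h : ∃ θ : lower K H.X j →ₐ[K] D, ∀ l : Set.Ico 1 j, θ (lowerGen K H.X l) = x l
  then h.choose else 0

open Classical in
/-- One step of the algorithm, deleting the `j`-th derivation. If `x_j ≠ 0` then `y_i = x_i` for
`i ≥ j` and `y_i = ∑ₙ q_j^{n(n+1)/2} (q_j - 1)^{-n} d_{j,n}(σ_j^{-n}(x_i)) x_j^{-n}` for `i < j`
(a finite sum). If `x_j = 0`, which only occurs in quotients, nothing is changed. -/
def step (x : ℕ → D) (j : ℕ) : ℕ → D := fun i =>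
  if h : x j ≠ 0 ∧ i ∈ Set.Ico 1 j then
    ∑ᶠ n : ℕ, (H.q j ^ (n * (n + 1) / 2) * ((H.q j - 1) ^ n)⁻¹) •
      (H.transport x j (H.d j n (((H.σ j)⁻¹ ^ n) (lowerGen K H.X ⟨i, h.2⟩))) * (x j ^ n)⁻¹)
  else x i

/-- The sequence obtained after `k` steps: the steps `j = N, N - 1, …, N - k + 1` have been made.
This is the sequence with superscript `(N + 1 - k)`. -/
def iter (x : ℕ → D) : ℕ → ℕ → D
  | 0 => x
  | k + 1 => H.step (iter x k) (N - k)

/-- The sequence with superscript `(j)`, for `2 ≤ j ≤ N + 1`; superscript `(N + 1)` is the initial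
sequence. -/
def seq (x : ℕ → D) (j : ℕ) : ℕ → D := H.iter x (N + 1 - j)

end Algorithm

/-! ### The canonical embedding of completely prime spectra -/

section Embedding

variable {F : Type*} [DivisionRing F] [Algebra K F] (ι : A →ₐ[K] F)

/-- `X_1, …, X_N` as elements of `Frac(A)`. -/
def genFrac : ℕ → F := fun i => ι (H.X i)

/-- The algebra `A^{(j)} = K⟨X_1^{(j)}, …, X_N^{(j)}⟩ ⊆ Frac(A)`. -/
abbrev algStep (j : ℕ) : Subalgebra K F := alg K N (H.seq (H.genFrac ι) j)

/-- The quantum affine space `A' = A^{(2)}` at the end of the algorithm. -/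
abbrev A' : Subalgebra K F := H.algStep ι 2

/-- The generators `T_i = X_i^{(2)}` of `A'`. -/
abbrev T (i : Set.Icc 1 N) : H.A' ι := gen K (H.seq (H.genFrac ι) 2) i

open Classical in
/-- The map `ψ_j`, from ideals `P` of the algebra generated by the `x_i` to ideals of the algebra
generated by the `y_i`. If `x_j ∈ P` it is `g_j⁻¹(P / ⟨x_j⟩)`, where `g_j` is the homomorphism
to the quotient by `⟨x_j⟩` with `y_i ↦ x_i + ⟨x_j⟩`; otherwise it is
`P S_j⁻¹ ∩ K⟨y_1, …, y_N⟩`, where `S_j` consists of the powers of `x_j`. Both sets are two-sided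
ideals already when the `y_i` come from the `x_i` by a step of the algorithm, so `span` only
serves to bundle them. -/
def psiStep (N : ℕ) (x y : ℕ → F) (j : ℕ) (P : TwoSidedIdeal (alg K N x)) :
    TwoSidedIdeal (alg K N y) :=
  if ∃ p ∈ P, (p : F) = x j then
    TwoSidedIdeal.span {a |
      ∃ g : alg K N y →ₐ[K] Quo (TwoSidedIdeal.span {b : alg K N x | (b : F) = x j}),
        (∀ i : Set.Icc 1 N, g (gen K y i) = quoMk K _ (gen K x i)) ∧
          ∃ p ∈ P, g a = quoMk K _ p}
  else
    TwoSidedIdeal.span {a | ∃ p ∈ P, ∃ n : ℕ, (a : F) = (p : F) * (x j ^ n)⁻¹}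

/-- The ideal obtained from `P` after `k` steps, `ψ_{N-k+1} ∘ ⋯ ∘ ψ_N (P)`. For `k = 0` it is `P`
seen as an ideal of the copy of `A` in `Frac(A)`. -/
def psiIter (P : TwoSidedIdeal A) :
    ∀ k : ℕ, TwoSidedIdeal (alg K N (H.iter (H.genFrac ι) k))
  | 0 => TwoSidedIdeal.span {a | ∃ p ∈ P, (a : F) = ι p}
  | k + 1 => psiStep N (H.iter (H.genFrac ι) k) (H.iter (H.genFrac ι) (k + 1)) (N - k)
      (psiIter P k)

/-- The canonical embedding `ψ = ψ_2 ∘ ⋯ ∘ ψ_N`. -/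
def psi (P : TwoSidedIdeal A) : TwoSidedIdeal (H.A' ι) := H.psiIter ι P (N + 1 - 2)

/-- `P ∈ C.Spec_w(A)`: `P` is completely prime, and `T_i ∈ ψ(P)` exactly for `i ∈ w`. -/
def CSpec (w : Set (Set.Icc 1 N)) (P : TwoSidedIdeal A) : Prop :=
  IsCompletelyPrime P ∧ ∀ i : Set.Icc 1 N, H.T ι i ∈ H.psi ι P ↔ i ∈ w

/-- `B' = A' / ψ(P)`. -/
abbrev B' (P : TwoSidedIdeal A) : Type _ := Quo (H.psi ι P)

/-- The canonical image `t_i` of `T_i` in `B'`. -/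
def t (P : TwoSidedIdeal A) (i : Set.Icc 1 N) : H.B' ι P := quoMk K _ (H.T ι i)

/-- The multiplicatively closed set `Σ` of `B'` generated by the `t_i` with `i ∉ w`. -/
def Sig (w : Set (Set.Icc 1 N)) (P : TwoSidedIdeal A) : Submonoid (H.B' ι P) :=
  Submonoid.closure (H.t ι P '' wᶜ)

end Embedding

/-! ### The algorithm in the division ring of fractions of `B = A / P` -/

section Quotient

variable (P : TwoSidedIdeal A) {G : Type*} [DivisionRing G] [Algebra K G]
  (κ : Quo P →ₐ[K] G)

/-- The images of `X_1, …, X_N` in `Frac(B)`, where `B = A / P`. -/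
def genQuot : ℕ → G := fun i => κ (quoMk K P (H.X i))

/-- The generators `X̄_i^{(j)}` of `B^{(j)} = A^{(j)} / P_j` as elements of `Frac(B)`. -/
def barX (j : ℕ) : ℕ → G := H.seq (H.genQuot P κ) j

/-- `B^{(j)}` as a subalgebra of `Frac(B)`. -/
def algBar (j : ℕ) : Subalgebra K G := alg K N (H.barX P κ j)

/-- The set `Σ_{m+2} ⊆ Frac(B)`: `Σ_2` is generated by the `X̄_i^{(2)} = t_i` with `i ∉ w`, and
`Σ_{j+1} = B^{(j+1)} ∩ Σ_j`. -/
def sigIter (w : Set (Set.Icc 1 N)) : ℕ → Submonoid G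
  | 0 => Submonoid.closure ((fun i : Set.Icc 1 N => H.barX P κ 2 i) '' wᶜ)
  | m + 1 => (H.algBar P κ (m + 3)).toSubmonoid ⊓ sigIter w m

/-- The multiplicatively closed set `Γ = Σ_{N+1}` of `B`. -/
def Gam (w : Set (Set.Icc 1 N)) : Submonoid (Quo P) :=
  (H.sigIter P κ w (N + 1 - 2)).comap κ

end Quotient

end QuantumNilpotentAlgebra

end

end DeletingDerivations

/-! One step of the algorithm rests on one computation. If `x` satisfies `x a = σ(a) x + δ(a)` on
the image of `R` and is nonzero, the deletion formula is an algebra homomorphism on `R`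
(`exists_deletionHom`), and its values commute with `x` up to `σ` (`mul_deletion`). The old and the
deleted elements generate the same algebra once `x` is inverted. In Frac(A) this turns one stage
into the next: an initial piece isomorphic to `A_{j-1}`, followed by skew polynomial variables
without derivations (`IsStage`, `IsStage.exists_step`).

In Frac(B) the entries satisfy more relations, so the stages are not rebuilt there. Instead a
homomorphism `A^{(j)} → Frac(B)`, sending generators to generators and having kernel exactly the
ideal produced by `ψ`, is carried through each step (`IsStage.exists_hom_step`). It passes through
the localization when `x_j` survives; when `x_j` dies, it comes from the universal property of the
iterated skew polynomial extension. At the end it embeds `B'` in Frac(B) (`exists_embedding`).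

A step at a nonzero entry `z` changes the algebra only up to powers of `z`. This `z` is already a
final entry with index outside `w`, hence lies in the current denominator set, so the right
fractions do not change; a step at zero changes nothing. Thus `B'Σ⁻¹ = BΓ⁻¹`
(`rightFractions_sigIter`).

The elements of `Σ` satisfy the right Ore condition and act invertibly through `φ'`, so `φ'` extends
to fractions (`exists_algHom_of_fractions`) and restricts to `φ` on `B`. Since `Γ` lies in `Σ`, its
elements also have scalar powers. A subspace stable under such an operator is stable under its
inverse, so a `B`-stable subspace is `B'`-stable, and irreducibility descends. -/

namespace DeletingDerivations

/-! ### Homomorphisms built from their graphs -/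

section Graph

variable {K : Type*} [Field K] {D Q : Type*} [Ring D] [Algebra K D] [Ring Q] [Algebra K Q]

/-- A subalgebra of `D × Q` that meets `0 × Q` trivially is the graph of a homomorphism. -/
theorem exists_algHom_of_graph (E : Subalgebra K (D × Q)) (hE : ∀ v, ((0 : D), v) ∈ E → v = 0)
    (U : Subalgebra K D) (hU : ∀ u ∈ U, ∃ v, (u, v) ∈ E) :
    ∃ h : U →ₐ[K] Q, ∀ u : U, ((u : D), h u) ∈ E := by
  have uniq : ∀ u v v', (u, v) ∈ E → (u, v') ∈ E → v = v' := by
    intro u v v' h h'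
    have := E.sub_mem h h'
    rw [Prod.mk_sub_mk, sub_self] at this
    exact sub_eq_zero.1 (hE _ this)
  choose! f hf using hU
  refine ⟨{ toFun := fun u => f u
            map_one' := ?_
            map_mul' := ?_
            map_zero' := ?_
            map_add' := ?_
            commutes' := ?_ }, fun u => hf u u.2⟩
  · exact uniq 1 _ _ (hf 1 U.one_mem) E.one_mem
  · exact fun a b => uniq _ _ _ (hf _ (U.mul_mem a.2 b.2)) (E.mul_mem (hf a a.2) (hf b b.2))
  · exact uniq 0 _ _ (hf 0 U.zero_mem) E.zero_mem
  · exact fun a b => uniq _ _ _ (hf _ (U.add_mem a.2 b.2)) (E.add_mem (hf a a.2) (hf b b.2))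
  · exact fun r => uniq _ _ _ (hf _ (U.algebraMap_mem r)) (E.algebraMap_mem r)

/-- Extension of a homomorphism to right fractions. -/
theorem exists_algHom_of_fractions {R : Type*} [Ring R] [Algebra K R] (f₁ : R →ₐ[K] D)
    (hf₁ : Function.Injective f₁) (f₂ : R →ₐ[K] Q) (S : Submonoid R)
    (hS : ∀ r, ∀ s ∈ S, ∃ r', ∃ s' ∈ S, r * s' = s * r')
    (h₂ : ∀ s ∈ S, IsUnit (f₂ s)) (U : Subalgebra K D)
    (hU : ∀ u ∈ U, ∃ s ∈ S, ∃ r, u * f₁ s = f₁ r) :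
    ∃ h : U →ₐ[K] Q, ∀ (u : U) (r : R), ∀ s ∈ S, (u : D) * f₁ s = f₁ r → h u * f₂ s = f₂ r := by
  -- Pairs admitting a common right denominator in `S`. The Ore condition `hS` gives closure under
  -- sums and products.
  let E : Subalgebra K (D × Q) :=
    { carrier := {p | ∃ s ∈ S, ∃ r, p.1 * f₁ s = f₁ r ∧ p.2 * f₂ s = f₂ r}
      mul_mem' := by
        rintro ⟨u, v⟩ ⟨u₂, v₂⟩ ⟨s, hs, r, h, h'⟩ ⟨s₂, hs₂, r₂, k, k'⟩
        obtain ⟨r', s', hs', e⟩ := hS r₂ s hs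
        refine ⟨s₂ * s', S.mul_mem hs₂ hs', r * r', ?_, ?_⟩
        · simp only [Prod.mk_mul_mk, map_mul] at *
          rw [mul_assoc, ← mul_assoc u₂, k, ← map_mul, e, map_mul, ← mul_assoc, h]
        · simp only [Prod.mk_mul_mk, map_mul] at *
          rw [mul_assoc, ← mul_assoc v₂, k', ← map_mul, e, map_mul, ← mul_assoc, h']
      add_mem' := by
        rintro ⟨u, v⟩ ⟨u₂, v₂⟩ ⟨s, hs, r, h, h'⟩ ⟨s₂, hs₂, r₂, k, k'⟩
        obtain ⟨r', s', hs', e⟩ := hS s s₂ hs₂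
        refine ⟨s * s', S.mul_mem hs hs', r * s' + r₂ * r', ?_, ?_⟩
        · simp only [Prod.mk_add_mk] at *
          rw [add_mul, map_add]
          congr 1
          · rw [map_mul, ← mul_assoc, h, map_mul]
          · rw [e, map_mul, ← mul_assoc, k, map_mul]
        · simp only [Prod.mk_add_mk] at *
          rw [add_mul, map_add]
          congr 1
          · rw [map_mul, ← mul_assoc, h', map_mul]
          · rw [e, map_mul, ← mul_assoc, k', map_mul]
      algebraMap_mem' := fun c => ⟨1, S.one_mem, algebraMap K R c, by simp, by simp⟩ }
  have hE : ∀ v, ((0 : D), v) ∈ E → v = 0 := by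
    rintro v ⟨s, hs, r, h, h'⟩
    simp only [zero_mul] at h
    have : r = 0 := hf₁ (by rw [← h, map_zero])
    rw [this, map_zero] at h'
    exact (h₂ s hs).mul_left_eq_zero.1 h'
  have ex : ∀ s ∈ S, ∀ u r, u * f₁ s = f₁ r → ∃ v, (u, v) ∈ E ∧ v * f₂ s = f₂ r := by
    intro s hs u r h
    obtain ⟨w, hw⟩ := h₂ s hs
    have : f₂ r * ↑w⁻¹ * f₂ s = f₂ r := by rw [← hw, Units.inv_mul_cancel_right]
    exact ⟨_, ⟨s, hs, r, h, this⟩, this⟩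
  obtain ⟨h, hh⟩ := exists_algHom_of_graph E hE U fun u hu => by
    obtain ⟨s, hs, r, e⟩ := hU u hu
    obtain ⟨v, hv, -⟩ := ex s hs u r e
    exact ⟨v, hv⟩
  refine ⟨h, fun u r s hs e => ?_⟩
  obtain ⟨v, hv, hv'⟩ := ex s hs u r e
  have := E.sub_mem (hh u) hv
  rw [Prod.mk_sub_mk, sub_self] at this
  rw [sub_eq_zero.1 (hE _ this), hv']

end Graph

/-! ### Skew polynomial extensions inside a division ring -/

section SkewPolynomial

variable {K : Type*} [Field K] {D Q : Type*} [DivisionRing D] [Algebra K D] [Ring Q] [Algebra K Q]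

/-- The powers of `z` are left linearly independent over `R`. -/
def PowersIndependent (R : Subalgebra K D) (z : D) : Prop :=
  ∀ p : ℕ →₀ R, (p.sum fun n r => (r : D) * z ^ n) = 0 → p = 0

theorem PowersIndependent.ne_zero {R : Subalgebra K D} {z : D} (h : PowersIndependent R z) :
    z ≠ 0 := by
  rintro rfl
  have := h (Finsupp.single 1 1) (by simp)
  simp at this

theorem conj_pow_mem {R : Subalgebra K D} {z : D} (hz : ∀ r ∈ R, z * r * z⁻¹ ∈ R) (n : ℕ) {r : D}
    (hr : r ∈ R) : z ^ n * r * (z ^ n)⁻¹ ∈ R := by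
  induction n with
  | zero => simpa using hr
  | succ n ih =>
    have := hz _ ih
    rw [pow_succ', mul_inv_rev]
    simpa only [mul_assoc] using this

/-- The universal property of a skew polynomial extension inside a division ring. -/
theorem exists_algHom_of_powersIndependent {R : Subalgebra K D} {z : D}
    (hind : PowersIndependent R z) (hz : ∀ r ∈ R, z * r * z⁻¹ ∈ R) (h : R →ₐ[K] Q) (t : Q)
    (ht : ∀ r r' : R, (r' : D) * z = z * r → t * h r = h r' * t) (U : Subalgebra K D)
    (hU : U ≤ Algebra.adjoin K (R ∪ {z})) :
    ∃ g : U →ₐ[K] Q, (∀ (u : U) (r : R), (u : D) = r → g u = h r) ∧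
      ∀ u : U, (u : D) = z → g u = t := by
  have hz0 := hind.ne_zero
  -- `L` evaluates one family of coefficients at `z` and, through `h`, at `t`. Its range is the
  -- graph; independence of the powers of `z` makes it single-valued.
  let L : (ℕ →₀ R) →ₗ[K] D × Q := Finsupp.lsum K fun n =>
    { toFun := fun r : R => ((r : D) * z ^ n, h r * t ^ n)
      map_add' := fun a b => by simp [add_mul]
      map_smul' := fun c a => by simp }
  have hL : ∀ n r, L (Finsupp.single n r) = ((r : D) * z ^ n, h r * t ^ n) := by
    intro n r
    simp only [L, Finsupp.coe_lsum, map_zero, Finsupp.sum_single_index]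
    rfl
  have hL1 : ∀ p, (L p).1 = p.sum fun n r => (r : D) * z ^ n := by
    intro p
    simp only [L, Finsupp.coe_lsum, Finsupp.sum, Prod.fst_sum]
    rfl
  have pw : ∀ n (r r' : R), (r' : D) * z ^ n = z ^ n * r → t ^ n * h r = h r' * t ^ n := by
    intro n
    induction n with
    | zero =>
      intro r r' e
      have : r' = r := Subtype.ext (by simpa using e)
      simp [this]
    | succ n ih =>
      intro r r' e
      let r₁ : R := ⟨z ^ n * r * (z ^ n)⁻¹, conj_pow_mem hz n r.2⟩
      have e₁ : (r₁ : D) * z ^ n = z ^ n * r := by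
        simp only [r₁]
        rw [inv_mul_cancel_right₀ (pow_ne_zero n hz0)]
      have e₂ : (r' : D) * z = z * r₁ := by
        apply mul_right_cancel₀ (pow_ne_zero n hz0)
        rw [mul_assoc, ← pow_succ', e, pow_succ', mul_assoc, mul_assoc, e₁]
      rw [pow_succ', mul_assoc, ih r r₁ e₁, ← mul_assoc, ht r₁ r' e₂, mul_assoc]
  have hmul : ∀ p p', L p * L p' ∈ Set.range L := by
    intro p p'
    induction p using Finsupp.induction_linear with
    | zero => exact ⟨0, by simp⟩
    | add a b ha hb =>
      obtain ⟨c, hc⟩ := ha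
      obtain ⟨d, hd⟩ := hb
      exact ⟨c + d, by rw [map_add, map_add, add_mul, hc, hd]⟩
    | single n r =>
      induction p' using Finsupp.induction_linear with
      | zero => exact ⟨0, by simp⟩
      | add a b ha hb =>
        obtain ⟨c, hc⟩ := ha
        obtain ⟨d, hd⟩ := hb
        exact ⟨c + d, by rw [map_add, map_add, mul_add, hc, hd]⟩
      | single m s =>
        let s₁ : R := ⟨z ^ n * s * (z ^ n)⁻¹, conj_pow_mem hz n s.2⟩
        have e₁ : (s₁ : D) * z ^ n = z ^ n * s := by
          simp only [s₁]
          rw [inv_mul_cancel_right₀ (pow_ne_zero n hz0)]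
        refine ⟨Finsupp.single (n + m) (r * s₁), ?_⟩
        rw [hL, hL, hL, Prod.mk_mul_mk]
        ext
        · simp only [MulMemClass.coe_mul]
          rw [pow_add, mul_assoc, ← mul_assoc (s₁ : D), e₁]
          simp only [mul_assoc]
        · simp only [map_mul]
          rw [pow_add, mul_assoc, ← mul_assoc (h s₁), ← pw n s s₁ e₁]
          simp only [mul_assoc]
  let E : Subalgebra K (D × Q) :=
    { carrier := Set.range L
      mul_mem' := by
        rintro _ _ ⟨p, rfl⟩ ⟨p', rfl⟩
        exact hmul p p'
      add_mem' := by
        rintro _ _ ⟨p, rfl⟩ ⟨p', rfl⟩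
        exact ⟨p + p', map_add _ _ _⟩
      algebraMap_mem' := fun c => ⟨Finsupp.single 0 (algebraMap K R c), by
        rw [hL]
        ext <;> simp⟩ }
  have hE : ∀ v, ((0 : D), v) ∈ E → v = 0 := by
    rintro v ⟨p, hp⟩
    have h1 := hL1 p
    rw [hp] at h1
    have := hind p h1.symm
    rw [this, map_zero] at hp
    exact (congrArg Prod.snd hp).symm
  have hR : ∀ r : R, ((r : D), h r) ∈ E := fun r => ⟨Finsupp.single 0 r, by rw [hL]; simp⟩
  have hzE : (z, t) ∈ E := ⟨Finsupp.single 1 1, by rw [hL]; simp⟩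
  have hUE : U ≤ E.map (AlgHom.fst K D Q) := by
    refine hU.trans (Algebra.adjoin_le ?_)
    rintro u (hu | hu)
    · exact ⟨_, hR ⟨u, hu⟩, rfl⟩
    · rw [Set.mem_singleton_iff] at hu
      exact ⟨_, hzE, hu.symm⟩
  obtain ⟨g, hg⟩ := exists_algHom_of_graph E hE U fun u hu => by
    obtain ⟨⟨u', v⟩, hv, e⟩ := hUE hu
    exact ⟨v, by cases e; exact hv⟩
  have uniq : ∀ u v v', (u, v) ∈ E → (u, v') ∈ E → v = v' := by
    intro u v v' h h'
    have := E.sub_mem h h'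
    rw [Prod.mk_sub_mk, sub_self] at this
    exact sub_eq_zero.1 (hE _ this)
  exact ⟨g, fun u r e => uniq _ _ _ (hg u) (e ▸ hR r), fun u e => uniq _ _ _ (hg u) (e ▸ hzE)⟩

end SkewPolynomial

/-! ### Gaussian binomials and the deletion coefficients -/

theorem gaussBinom_of_lt {K : Type*} [Field K] (q : K) {n k : ℕ} (h : n < k) :
    gaussBinom q n k = 0 := by
  induction n generalizing k with
  | zero => obtain ⟨k, rfl⟩ := Nat.exists_eq_succ_of_ne_zero h.ne'; rfl
  | succ n ih =>
    obtain ⟨k, rfl⟩ := Nat.exists_eq_succ_of_ne_zero (Nat.ne_of_gt (Nat.zero_lt_of_lt h))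
    rw [gaussBinom, ih (by omega), ih (by omega), mul_zero, add_zero]

theorem gaussBinom_self {K : Type*} [Field K] (q : K) (n : ℕ) : gaussBinom q n n = 1 := by
  induction n with
  | zero => rfl
  | succ n ih => rw [gaussBinom, ih, gaussBinom_of_lt q n.lt_succ_self, mul_zero, add_zero]

theorem gaussBinom_succ_self {K : Type*} [Field K] (q : K) (n : ℕ) :
    gaussBinom q (n + 1) n * (q - 1) = q ^ (n + 1) - 1 := by
  induction n with
  | zero => simp [gaussBinom]
  | succ n ih => rw [gaussBinom, add_mul, ih, gaussBinom_self]; ring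

/-- The coefficient `q^{n(n+1)/2} (q-1)^{-n}` of the deleting derivations formula. -/
noncomputable def delCoeff {K : Type*} [Field K] (q : K) (n : ℕ) : K :=
  q ^ (n * (n + 1) / 2) * ((q - 1) ^ n)⁻¹

section Coeff

variable {K : Type*} [Field K] {q : K}

@[simp]
theorem delCoeff_zero : delCoeff q 0 = 1 := by simp [delCoeff]

theorem triangle_add (n m : ℕ) :
    (n + m) * (n + m + 1) / 2 = n * m + (n * (n + 1) / 2 + m * (m + 1) / 2) := by
  obtain ⟨a, ha⟩ := (Nat.even_mul_succ_self n).two_dvd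
  obtain ⟨b, hb⟩ := (Nat.even_mul_succ_self m).two_dvd
  have : (n + m) * (n + m + 1) = 2 * (n * m + (a + b)) := by
    rw [Nat.mul_add 2, Nat.mul_add 2, ← ha, ← hb]
    ring
  rw [this, show n * (n + 1) = 2 * a from ha, show m * (m + 1) = 2 * b from hb]
  omega

/-- The cross factor `q ^ (n * m)` cancels the power of `q⁻¹` in `IsHigherSkewDerivation.pow_apply`;
this makes the deletion multiplicative. -/
theorem delCoeff_add (n m : ℕ) :
    delCoeff q (n + m) = q ^ (n * m) * (delCoeff q n * delCoeff q m) := by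
  simp only [delCoeff]
  rw [triangle_add, pow_add, pow_add, pow_add, mul_inv]
  ring

/-- The recursion behind the telescoping in `mul_deletion`. It is free of division by `q ^ (n + 1) -
1`, so `q` may be a root of unity. -/
theorem delCoeff_succ (hq1 : q ≠ 1) (n : ℕ) :
    delCoeff q (n + 1) * (q ^ (n + 1) - 1) =
      q ^ (n + 1) * (delCoeff q n * gaussBinom q (n + 1) n) := by
  have h1 : q - 1 ≠ 0 := sub_ne_zero.2 hq1
  rw [delCoeff_add, ← gaussBinom_succ_self]
  have : delCoeff q 1 = q * (q - 1)⁻¹ := by simp [delCoeff]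
  rw [this]
  field_simp
  ring

end Coeff

/-! ### Higher skew derivations and the deletion homomorphism -/

section Skew

variable {K : Type*} [Field K] {R : Type*} [Ring R] [Algebra K R] {q : K} {σ : R ≃ₐ[K] R}
  {δ : R →ₗ[K] R} {d : ℕ → R →ₗ[K] R}

namespace IsHigherSkewDerivation

theorem apply_symm_pow (hd : IsHigherSkewDerivation q σ δ d) (hq : q ≠ 0) (n k : ℕ) (a : R) :
    d n ((σ⁻¹ ^ k) a) = (q⁻¹) ^ (n * k) • (σ⁻¹ ^ k) (d n a) := by
  induction k with
  | zero => simp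
  | succ k ih =>
    have h := hd.skew n ((σ⁻¹ ^ (k + 1)) a)
    have e : σ ((σ⁻¹ ^ (k + 1)) a) = (σ⁻¹ ^ k) a := by
      rw [pow_succ', AlgEquiv.mul_apply]
      exact σ.apply_symm_apply _
    have e' : σ⁻¹ (σ (d n ((σ⁻¹ ^ (k + 1)) a))) = d n ((σ⁻¹ ^ (k + 1)) a) :=
      σ.symm_apply_apply _
    rw [e, ih] at h
    have h2 := congrArg (fun r => (q⁻¹) ^ n • σ⁻¹ r) h
    simp only [map_smul, e', smul_smul] at h2
    rw [← mul_pow, inv_mul_cancel₀ hq, one_pow, one_smul] at h2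
    rw [← h2, pow_succ' σ⁻¹, AlgEquiv.mul_apply, mul_add, mul_one, pow_add, mul_comm]

theorem vanish_symm_pow (hd : IsHigherSkewDerivation q σ δ d) (hq : q ≠ 0) {a : R} {n : ℕ}
    (h : d n a = 0) (k : ℕ) : d n ((σ⁻¹ ^ k) a) = 0 := by
  rw [hd.apply_symm_pow hq, h, map_zero, smul_zero]

theorem pow_apply (hd : IsHigherSkewDerivation q σ δ d) (hq : q ≠ 0) (n k m : ℕ) (a : R) :
    (σ ^ k) (d n ((σ⁻¹ ^ (m + k)) a)) = (q⁻¹) ^ (n * k) • d n ((σ⁻¹ ^ m) a) := by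
  have : (σ⁻¹ ^ (m + k)) a = (σ⁻¹ ^ k) ((σ⁻¹ ^ m) a) := by
    rw [add_comm, pow_add, AlgEquiv.mul_apply]
  rw [this, hd.apply_symm_pow hq, map_smul, ← AlgEquiv.mul_apply, inv_pow σ, mul_inv_cancel,
    AlgEquiv.one_apply]

theorem map_one (hd : IsHigherSkewDerivation q σ δ d) (n : ℕ) (hn : 1 ≤ n) : d n 1 = 0 := by
  induction n using Nat.strong_induction_on with
  | _ n ih =>
    obtain ⟨n, rfl⟩ := Nat.exists_eq_add_of_le' hn
    have h := hd.mul (n + 1) 1 1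
    rw [Finset.sum_range_succ, Finset.sum_range_succ', Finset.sum_eq_zero] at h
    · simpa [hd.zero] using h
    · intro i hi
      rw [ih (i + 1) (by simpa using hi) (by omega), map_zero, zero_mul]

theorem delta_apply (hd : IsHigherSkewDerivation q σ δ d) (n : ℕ) (a : R) :
    δ (d n a) = gaussBinom q (n + 1) n • d (n + 1) a := by
  rw [← hd.one, hd.iterative, add_comm]

end IsHigherSkewDerivation

variable {D : Type*} [DivisionRing D] [Algebra K D]

/-- The deleting derivations formula for an element `a` of `R`. -/
noncomputable def deletion (q : K) (σ : R ≃ₐ[K] R) (d : ℕ → R →ₗ[K] R) (θ : R → D) (x : D)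
    (a : R) : D :=
  ∑ᶠ n : ℕ, delCoeff q n • (θ (d n ((σ⁻¹ ^ n) a)) * (x ^ n)⁻¹)

namespace IsHigherSkewDerivation

theorem deletion_eq_sum (hd : IsHigherSkewDerivation q σ δ d) (hq : q ≠ 0) (θ : R →ₐ[K] D) (x : D)
    {a : R} {m : ℕ} (h : ∀ n, m ≤ n → d n a = 0) :
    deletion q σ d θ x a =
      ∑ n ∈ Finset.range m, delCoeff q n • (θ (d n ((σ⁻¹ ^ n) a)) * (x ^ n)⁻¹) := by
  apply finsum_eq_sum_of_support_subset
  intro n hn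
  by_contra hn'
  apply hn
  have : m ≤ n := by simpa using hn'
  change delCoeff q n • (θ (d n ((σ⁻¹ ^ n) a)) * (x ^ n)⁻¹) = 0
  rw [hd.vanish_symm_pow hq (h n this), map_zero, zero_mul, smul_zero]

/-- A common bound for the vanishing of the higher derivations on finitely many elements. -/
theorem exists_bound (hd : IsHigherSkewDerivation q σ δ d) (s : Finset R) :
    ∃ m, ∀ a ∈ s, ∀ n, m ≤ n → d n a = 0 := by
  choose f hf using hd.locallyNilpotent
  exact ⟨s.sup f, fun a ha n hn => hf a n ((Finset.le_sup ha).trans hn)⟩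

/-- `x` commutes with the deleted elements up to `σ`: the derivation has been deleted. -/
theorem mul_deletion (hd : IsHigherSkewDerivation q σ δ d) (hq : q ≠ 0) (hq1 : q ≠ 1)
    (θ : R →ₐ[K] D) {x : D} (hx : x ≠ 0) (hc : ∀ a, x * θ a = θ (σ a) * x + θ (δ a)) (a : R) :
    x * deletion q σ d θ x a = deletion q σ d θ x (σ a) * x := by
  obtain ⟨M, hM⟩ := hd.locallyNilpotent a
  have hM' : ∀ n, M ≤ n → d n (σ a) = 0 := fun n hn => by
    rw [hd.skew, hM n hn, map_zero, smul_zero]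
  rw [hd.deletion_eq_sum hq θ x hM, hd.deletion_eq_sum hq θ x hM', Finset.mul_sum,
    Finset.sum_mul]
  let e : ℕ → R := fun n => d n ((σ⁻¹ ^ n) (σ a))
  -- Moving `x` through the `n`-th term produces an error from `σ` and one from `δ`; by
  -- `delCoeff_succ` together they are `g (n + 1) - g n`.
  let g : ℕ → D := fun n => (delCoeff q n * (1 - (q⁻¹) ^ n)) • (θ (e n) * (x ^ n)⁻¹ * x)
  have hσ : ∀ n, σ (d n ((σ⁻¹ ^ n) a)) = (q⁻¹) ^ n • e n := by
    intro n
    have h := hd.pow_apply hq n 1 n (σ a)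
    rw [mul_one, pow_one] at h
    rw [← h, pow_succ, AlgEquiv.mul_apply]
    congr 3
    exact (σ.symm_apply_apply a).symm
  have hδ : ∀ n, δ (d n ((σ⁻¹ ^ n) a)) = gaussBinom q (n + 1) n • e (n + 1) := by
    intro n
    rw [hd.delta_apply]
    simp only [e]
    rw [pow_succ, AlgEquiv.mul_apply]
    congr 3
    exact (σ.symm_apply_apply a).symm
  have key : ∀ n, x * (delCoeff q n • (θ (d n ((σ⁻¹ ^ n) a)) * (x ^ n)⁻¹)) =
      delCoeff q n • (θ (e n) * (x ^ n)⁻¹) * x - g n + g (n + 1) := by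
    intro n
    have h3 : (x ^ n)⁻¹ * x = x * (x ^ n)⁻¹ := ((Commute.refl x).pow_right n).inv_right₀.eq.symm
    have h4 : (x ^ (n + 1))⁻¹ * x = (x ^ n)⁻¹ := by
      rw [pow_succ', mul_inv_rev, mul_assoc, inv_mul_cancel₀ hx, mul_one]
    have h5 : delCoeff q (n + 1) * (1 - (q⁻¹) ^ (n + 1)) =
        delCoeff q n * gaussBinom q (n + 1) n := by
      have := delCoeff_succ hq1 n
      have hqn : q ^ (n + 1) ≠ 0 := pow_ne_zero _ hq
      apply mul_left_cancel₀ hqn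
      rw [← this, inv_pow]
      field_simp
    simp only [g]
    rw [h5, mul_assoc (θ (e (n + 1))), h4, mul_smul_comm, ← mul_assoc, hc, hσ, hδ, map_smul,
      map_smul, smul_mul_assoc (delCoeff q n), mul_assoc (θ (e n)), h3, add_mul, mul_assoc _ x,
      smul_add, smul_mul_assoc, smul_mul_assoc, smul_smul, smul_smul, mul_sub, mul_one, sub_smul]
    abel
  -- Both boundary terms vanish: `g 0` because its scalar is zero, `g M` by nilpotence.
  have hsum : ∑ n ∈ Finset.range M, g n = ∑ n ∈ Finset.range M, g (n + 1) := by
    have h1 := Finset.sum_range_succ g M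
    have h2 := Finset.sum_range_succ' g M
    have g0 : g 0 = 0 := by simp [g]
    have gM : g M = 0 := by
      simp only [g, e]
      rw [hd.vanish_symm_pow hq (hM' M le_rfl), map_zero, zero_mul, zero_mul, smul_zero]
    rw [g0, add_zero] at h2
    rw [gM, add_zero] at h1
    rw [← h1, h2]
  rw [Finset.sum_congr rfl fun n _ => key n, Finset.sum_add_distrib, Finset.sum_sub_distrib,
    hsum, sub_add_cancel]

theorem inv_pow_mul_deletion (hd : IsHigherSkewDerivation q σ δ d) (hq : q ≠ 0) (hq1 : q ≠ 1)
    (θ : R →ₐ[K] D) {x : D} (hx : x ≠ 0) (hc : ∀ a, x * θ a = θ (σ a) * x + θ (δ a)) (n : ℕ)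
    (a : R) :
    (x ^ n)⁻¹ * deletion q σ d θ x a = deletion q σ d θ x ((σ⁻¹ ^ n) a) * (x ^ n)⁻¹ := by
  induction n with
  | zero => simp
  | succ n ih =>
    have h := hd.mul_deletion hq hq1 θ hx hc ((σ⁻¹ ^ (n + 1)) a)
    have e : σ ((σ⁻¹ ^ (n + 1)) a) = (σ⁻¹ ^ n) a := by
      rw [pow_succ', AlgEquiv.mul_apply]
      exact σ.apply_symm_apply _
    rw [e] at h
    have h' : x⁻¹ * deletion q σ d θ x ((σ⁻¹ ^ n) a) =
        deletion q σ d θ x ((σ⁻¹ ^ (n + 1)) a) * x⁻¹ := by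
      rw [inv_mul_eq_iff_eq_mul₀ hx, ← mul_assoc, h, mul_assoc, mul_inv_cancel₀ hx, mul_one]
    rw [pow_succ x, mul_inv_rev, mul_assoc, ih, ← mul_assoc, h', mul_assoc]

/-- On the left the twisted Leibniz rule gives a sum over `i + m = n`. On the right
`inv_pow_mul_deletion` moves `x ^ (-i)` past the second factor. Both become the same double sum of
terms `h i m`. -/
theorem deletion_mul (hd : IsHigherSkewDerivation q σ δ d) (hq : q ≠ 0) (hq1 : q ≠ 1)
    (θ : R →ₐ[K] D) {x : D} (hx : x ≠ 0) (hc : ∀ a, x * θ a = θ (σ a) * x + θ (δ a)) (a b : R) :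
    deletion q σ d θ x (a * b) = deletion q σ d θ x a * deletion q σ d θ x b := by
  classical
  obtain ⟨M, hM⟩ := hd.exists_bound {a, b}
  have ha : ∀ n, M ≤ n → d n a = 0 := hM a (by simp)
  have hb : ∀ n, M ≤ n → d n b = 0 := hM b (by simp)
  -- For `n ≥ 2 * M`, either `i` or `n - i` is at least `M` in each Leibniz term.
  have hab : ∀ n, 2 * M ≤ n → d n (a * b) = 0 := by
    intro n hn
    rw [hd.mul]
    refine Finset.sum_eq_zero fun i _ => ?_
    by_cases hi : M ≤ i
    · rw [ha i hi, map_zero, zero_mul]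
    · rw [hb (n - i) (by omega), mul_zero]
  let h : ℕ → ℕ → D := fun i m => (delCoeff q i * delCoeff q m) •
    (θ (d i ((σ⁻¹ ^ i) a)) * θ (d m ((σ⁻¹ ^ (m + i)) b)) * (x ^ (i + m))⁻¹)
  have h1 : ∀ i m, M ≤ i → h i m = 0 := fun i m hi => by
    simp only [h]
    rw [hd.vanish_symm_pow hq (ha i hi), map_zero, zero_mul, zero_mul, smul_zero]
  have h2 : ∀ i m, M ≤ m → h i m = 0 := fun i m hi => by
    simp only [h]
    rw [hd.vanish_symm_pow hq (hb m hi), map_zero, mul_zero, zero_mul, smul_zero]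
  have hr : deletion q σ d θ x a * deletion q σ d θ x b =
      ∑ i ∈ Finset.range M, ∑ m ∈ Finset.range M, h i m := by
    rw [hd.deletion_eq_sum hq θ x ha, Finset.sum_mul]
    refine Finset.sum_congr rfl fun i _ => ?_
    rw [smul_mul_assoc, mul_assoc, hd.inv_pow_mul_deletion hq hq1 θ hx hc,
      hd.deletion_eq_sum hq θ x fun n hn => hd.vanish_symm_pow hq (hb n hn) i, Finset.sum_mul,
      Finset.mul_sum, Finset.smul_sum]
    refine Finset.sum_congr rfl fun m _ => ?_
    simp only [h]
    rw [pow_add σ⁻¹, AlgEquiv.mul_apply, pow_add, mul_inv_rev, smul_mul_assoc, mul_smul_comm,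
      smul_smul]
    have : (x ^ m)⁻¹ * (x ^ i)⁻¹ = (x ^ i)⁻¹ * (x ^ m)⁻¹ := by
      rw [← mul_inv_rev, ← mul_inv_rev, ← pow_add, ← pow_add, add_comm]
    simp only [mul_assoc, this]
  have hl : deletion q σ d θ x (a * b) =
      ∑ n ∈ Finset.range (2 * M), ∑ i ∈ Finset.range (n + 1), h i (n - i) := by
    rw [hd.deletion_eq_sum hq θ x hab]
    refine Finset.sum_congr rfl fun n _ => ?_
    rw [map_mul, hd.mul, map_sum, Finset.sum_mul, Finset.smul_sum]
    refine Finset.sum_congr rfl fun i hi => ?_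
    obtain ⟨m, rfl⟩ := Nat.exists_eq_add_of_le (Nat.lt_succ_iff.1 (Finset.mem_range.1 hi))
    rw [Nat.add_sub_cancel_left]
    simp only [h]
    rw [hd.pow_apply hq, map_mul, map_smul, smul_mul_assoc, smul_mul_assoc, smul_smul,
      delCoeff_add, add_comm m i]
    congr 1
    rw [mul_right_comm, ← mul_pow, mul_inv_cancel₀ hq, one_pow, one_mul]
  -- The triangle of side `2 * M` contains the square of side `M`, outside which `h` vanishes.
  rw [hl, hr, Finset.sum_range_diag_flip]
  rw [← Finset.sum_subset (Finset.range_subset_range.2 (by omega : M ≤ 2 * M))]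
  · refine Finset.sum_congr rfl fun i hi => ?_
    have hi' := Finset.mem_range.1 hi
    rw [← Finset.sum_subset (Finset.range_subset_range.2 (by omega : M ≤ 2 * M - i))]
    intro m _ hm
    exact h2 i m (by simpa using hm)
  · intro i _ hi
    exact Finset.sum_eq_zero fun m _ => h1 i m (by simpa using hi)

/-- The deleting derivations homomorphism `R → D`. -/
theorem exists_deletionHom (hd : IsHigherSkewDerivation q σ δ d) (hq : q ≠ 0) (hq1 : q ≠ 1)
    (θ : R →ₐ[K] D) {x : D} (hx : x ≠ 0) (hc : ∀ a, x * θ a = θ (σ a) * x + θ (δ a)) :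
    ∃ φ : R →ₐ[K] D, ∀ a, φ a = deletion q σ d θ x a := by
  classical
  have hone : deletion q σ d θ x 1 = 1 := by
    rw [hd.deletion_eq_sum hq θ x (m := 1) fun n hn => hd.map_one n hn]
    simp [hd.zero]
  have hadd : ∀ a b, deletion q σ d θ x (a + b) = deletion q σ d θ x a + deletion q σ d θ x b := by
    intro a b
    obtain ⟨M, hM⟩ := hd.exists_bound {a, b, a + b}
    rw [hd.deletion_eq_sum hq θ x (hM a (by simp)), hd.deletion_eq_sum hq θ x (hM b (by simp)),
      hd.deletion_eq_sum hq θ x (hM (a + b) (by simp)), ← Finset.sum_add_distrib]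
    exact Finset.sum_congr rfl fun n _ => by simp [add_mul]
  have hsmul : ∀ (c : K) a, deletion q σ d θ x (c • a) = c • deletion q σ d θ x a := by
    intro c a
    obtain ⟨M, hM⟩ := hd.exists_bound {a, c • a}
    rw [hd.deletion_eq_sum hq θ x (hM a (by simp)),
      hd.deletion_eq_sum hq θ x (hM (c • a) (by simp)), Finset.smul_sum]
    exact Finset.sum_congr rfl fun n _ => by simp [smul_comm c]
  let L : R →ₗ[K] D := ⟨⟨deletion q σ d θ x, hadd⟩, hsmul⟩
  exact ⟨AlgHom.ofLinearMap L hone (hd.deletion_mul hq hq1 θ hx hc), fun a => rfl⟩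

end IsHigherSkewDerivation

end Skew

/-! ### Denominators that are powers of one element -/

section Ore

variable {K : Type*} [Field K] {D : Type*} [DivisionRing D] [Algebra K D]

/-- The right Ore condition for the powers of `x` in `S`. -/
def IsOrePowers (S : Subalgebra K D) (x : D) : Prop :=
  ∀ u ∈ S, ∀ n : ℕ, ∃ m : ℕ, ∃ p ∈ S, u * x ^ m = x ^ n * p

theorem isOrePowers_adjoin {s : Set D} {x : D} (hx : x ∈ Algebra.adjoin K s)
    (h : ∀ u ∈ s, ∀ n : ℕ, ∃ m : ℕ, ∃ p ∈ Algebra.adjoin K s, u * x ^ m = x ^ n * p) :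
    IsOrePowers (Algebra.adjoin K s) x := by
  intro u hu
  induction hu using Algebra.adjoin_induction with
  | mem u hu => exact h u hu
  | algebraMap r =>
    exact fun n => ⟨n, algebraMap K D r, Subalgebra.algebraMap_mem _ r, Algebra.commutes r _⟩
  | add u v _ _ hu hv =>
    intro n
    obtain ⟨m, p, hp, e⟩ := hu n
    obtain ⟨m', p', hp', e'⟩ := hv n
    refine ⟨m + m', p * x ^ m' + p' * x ^ m, add_mem (mul_mem hp (pow_mem hx _))
      (mul_mem hp' (pow_mem hx _)), ?_⟩
    rw [add_mul, pow_add, ← mul_assoc, e, ← pow_add, add_comm m, pow_add, ← mul_assoc, e', mul_add,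
      mul_assoc, mul_assoc]
  | mul u v _ _ hu hv =>
    intro n
    obtain ⟨m, p, hp, e⟩ := hu n
    obtain ⟨m', p', hp', e'⟩ := hv m
    exact ⟨m', p * p', mul_mem hp hp', by rw [mul_assoc, e', ← mul_assoc, e, mul_assoc]⟩

theorem exists_sum_mul_pow_mem {S : Subalgebra K D} {x : D} (hx : x ∈ S) {α : Type*}
    (s : Finset α) (f : α → D) (h : ∀ a ∈ s, ∃ n : ℕ, f a * x ^ n ∈ S) :
    ∃ n : ℕ, ∀ a ∈ s, f a * x ^ n ∈ S := by
  choose! g hg using h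
  refine ⟨s.sup g, fun a ha => ?_⟩
  obtain ⟨k, hk⟩ := Nat.exists_eq_add_of_le (Finset.le_sup (f := g) ha)
  rw [hk, pow_add, ← mul_assoc]
  exact mul_mem (hg a ha) (pow_mem hx _)

/-- The elements with a denominator `x ^ n` form a subalgebra. -/
theorem IsOrePowers.exists_mul_pow_mem {S : Subalgebra K D} {x : D} (hS : IsOrePowers S x)
    (hx : x ∈ S) {s : Set D} (h : ∀ u ∈ s, ∃ n : ℕ, u * x ^ n ∈ S) :
    ∀ u ∈ Algebra.adjoin K s, ∃ n : ℕ, u * x ^ n ∈ S := by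
  intro u hu
  induction hu using Algebra.adjoin_induction with
  | mem u hu => exact h u hu
  | algebraMap r => exact ⟨0, by simp⟩
  | add u v _ _ hu hv =>
    obtain ⟨m, p⟩ := hu
    obtain ⟨m', p'⟩ := hv
    refine ⟨m + m', ?_⟩
    rw [add_mul, pow_add, ← mul_assoc, ← pow_add, add_comm m, pow_add, ← mul_assoc]
    exact add_mem (mul_mem p (pow_mem hx _)) (mul_mem p' (pow_mem hx _))
  | mul u v _ _ hu hv =>
    obtain ⟨m, p⟩ := hu
    obtain ⟨m', p'⟩ := hv
    obtain ⟨k, c, hc, e⟩ := hS _ p' m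
    refine ⟨m' + k, ?_⟩
    rw [mul_assoc, pow_add, ← mul_assoc v, e, ← mul_assoc]
    exact mul_mem p hc

end Ore

namespace IsHigherSkewDerivation

variable {K : Type*} [Field K] {R : Type*} [Ring R] [Algebra K R] {q : K} {σ : R ≃ₐ[K] R}
  {δ : R →ₗ[K] R} {d : ℕ → R →ₗ[K] R} {D : Type*} [DivisionRing D] [Algebra K D]

/-- Pulling one `x` to the left of `θ a` replaces `a` by `σ⁻¹ a` and leaves the error `δ (σ⁻¹ a)`,
whose nilpotence bound is one smaller. Hence the outer induction on the bound and the inner one on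
`n`. -/
theorem exists_mul_pow_eq (hd : IsHigherSkewDerivation q σ δ d) (hq : q ≠ 0)
    (θ : R →ₐ[K] D) {x : D} (hc : ∀ a, x * θ a = θ (σ a) * x + θ (δ a)) {S : Subalgebra K D}
    (hx : x ∈ S) (hθ : ∀ a, θ a ∈ S) (a : R) (n : ℕ) :
    ∃ m : ℕ, ∃ p ∈ S, θ a * x ^ m = x ^ n * p := by
  obtain ⟨M, hM⟩ := hd.locallyNilpotent a
  induction M generalizing a n with
  | zero =>
    have : a = 0 := by rw [← hd.zero a]; exact hM 0 le_rfl
    exact ⟨0, 0, S.zero_mem, by simp [this]⟩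
  | succ M ihM =>
    induction n generalizing a with
    | zero => exact ⟨0, θ a, hθ a, by simp⟩
    | succ n ihn =>
      have hσ : ∀ k, M + 1 ≤ k → d k (σ⁻¹ a) = 0 := fun k hk => by
        have := hd.vanish_symm_pow hq (hM k hk) 1
        rwa [pow_one] at this
      have hb : ∀ k, M ≤ k → d k (δ (σ⁻¹ a)) = 0 := fun k hk => by
        rw [← hd.one, hd.iterative, hσ _ (by omega), smul_zero]
      obtain ⟨m, p, hp, e⟩ := ihn _ hσ
      obtain ⟨m', p', hp', e'⟩ := ihM _ (n + 1) hb
      have h1 : θ a * x = x * θ (σ⁻¹ a) - θ (δ (σ⁻¹ a)) := by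
        have : σ (σ⁻¹ a) = a := σ.apply_symm_apply a
        rw [hc, this, add_sub_cancel_right]
      refine ⟨1 + (m + m'), p * x ^ m' - p' * x ^ m, sub_mem (mul_mem hp (pow_mem hx _))
        (mul_mem hp' (pow_mem hx _)), ?_⟩
      rw [pow_add, pow_one, ← mul_assoc, h1, sub_mul, pow_add, mul_assoc, ← mul_assoc (θ (σ⁻¹ a)),
        e, ← pow_add, add_comm m m', pow_add, ← mul_assoc (θ (δ (σ⁻¹ a))), e', mul_sub, pow_succ']
      simp only [mul_assoc]

theorem deletion_mul_pow (hd : IsHigherSkewDerivation q σ δ d) (hq : q ≠ 0) (θ : R →ₐ[K] D)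
    {x : D} (hx : x ≠ 0) {a : R} {m : ℕ} (h : ∀ n, m ≤ n → d n a = 0) :
    deletion q σ d θ x a * x ^ m =
      ∑ n ∈ Finset.range m, delCoeff q n • (θ (d n ((σ⁻¹ ^ n) a)) * x ^ (m - n)) := by
  rw [hd.deletion_eq_sum hq θ x h, Finset.sum_mul]
  refine Finset.sum_congr rfl fun n hn => ?_
  obtain ⟨k, rfl⟩ := Nat.exists_eq_add_of_le (Finset.mem_range.1 hn).le
  rw [Nat.add_sub_cancel_left, pow_add, smul_mul_assoc, mul_assoc,
    inv_mul_cancel_left₀ (pow_ne_zero _ hx)]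

theorem exists_deletion_mul_pow_mem (hd : IsHigherSkewDerivation q σ δ d) (hq : q ≠ 0)
    (θ : R →ₐ[K] D) {x : D} (hx : x ≠ 0) {S : Subalgebra K D} (hxS : x ∈ S) (hθ : ∀ a, θ a ∈ S)
    (a : R) : ∃ m : ℕ, deletion q σ d θ x a * x ^ m ∈ S := by
  obtain ⟨M, hM⟩ := hd.locallyNilpotent a
  refine ⟨M, ?_⟩
  rw [hd.deletion_mul_pow hq θ hx hM]
  exact sum_mem fun n _ => S.smul_mem (mul_mem (hθ _) (pow_mem hxS _)) _

/-- Conversely, the original elements are obtained from the deleted ones by inverting `x`. -/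
theorem exists_mul_pow_mem_of_deletion (hd : IsHigherSkewDerivation q σ δ d) (hq : q ≠ 0)
    (θ : R →ₐ[K] D) {x : D} (hx : x ≠ 0) {S : Subalgebra K D} (hxS : x ∈ S)
    (hθ : ∀ a, deletion q σ d θ x a ∈ S) (a : R) : ∃ m : ℕ, θ a * x ^ m ∈ S := by
  obtain ⟨M, hM⟩ := hd.locallyNilpotent a
  induction M using Nat.strong_induction_on generalizing a with
  | _ M ih =>
    cases M with
    | zero =>
      have : a = 0 := by rw [← hd.zero a]; exact hM 0 le_rfl
      exact ⟨0, by simp [this]⟩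
    | succ M =>
      have h1 := hd.deletion_mul_pow hq θ hx hM
      rw [Finset.sum_range_succ'] at h1
      simp only [pow_zero, AlgEquiv.one_apply, hd.zero, delCoeff_zero, one_smul,
        Nat.sub_zero] at h1
      -- The correction terms involve only `d (n + 1)`, which by iterativity lowers the nilpotence
      -- bound to at most `M`, so induction applies to them.
      have h2 : ∀ n ∈ Finset.range M, ∃ k : ℕ, delCoeff q (n + 1) •
          (θ (d (n + 1) ((σ⁻¹ ^ (n + 1)) a)) * x ^ (M + 1 - (n + 1))) * x ^ k ∈ S := by
        intro n _
        obtain ⟨k, hk⟩ := ih M M.lt_succ_self (d (n + 1) ((σ⁻¹ ^ (n + 1)) a)) fun i hi => by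
          rw [hd.iterative, hd.vanish_symm_pow hq (hM _ (by omega)), smul_zero]
        refine ⟨k, ?_⟩
        rw [smul_mul_assoc, mul_assoc, ← pow_add, add_comm _ k, pow_add x k, ← mul_assoc]
        exact S.smul_mem (mul_mem hk (pow_mem hxS _)) _
      obtain ⟨k, hk⟩ := exists_sum_mul_pow_mem hxS _ _ h2
      refine ⟨M + 1 + k, ?_⟩
      rw [pow_add, ← mul_assoc, ← sub_eq_iff_eq_add'.2 h1, sub_mul, Finset.sum_mul]
      exact sub_mem (mul_mem (mul_mem (hθ a) (pow_mem hxS _)) (pow_mem hxS _))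
        (sum_mem fun n hn => hk n hn)

/-- A deleted element is the original plus terms of lower degree in `x`, so the top coefficient of a
relation survives after clearing denominators. -/
theorem deletion_independent (hd : IsHigherSkewDerivation q σ δ d) (hq : q ≠ 0)
    (θ : R →ₐ[K] D) {x : D} (hx : x ≠ 0)
    (hθ : ∀ p : ℕ →₀ R, (p.sum fun n r => θ r * x ^ n) = 0 → p = 0) (p : ℕ →₀ R)
    (hp : (p.sum fun n r => deletion q σ d θ x r * x ^ n) = 0) : p = 0 := by
  classical
  by_contra hne
  have hsup : p.support.Nonempty := Finsupp.support_nonempty_iff.2 hne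
  let M := p.support.max' hsup
  obtain ⟨s, hs⟩ := hd.exists_bound (p.support.image p)
  have hs' : ∀ n ∈ p.support, ∀ k, s ≤ k → d k (p n) = 0 := fun n hn =>
    hs (p n) (Finset.mem_image_of_mem _ hn)
  -- The relation `p` multiplied by `x ^ s`, rewritten in the original elements. In degree `M + s`
  -- only `n = M`, `k = 0` contributes.
  let b : ℕ →₀ R := ∑ n ∈ p.support, ∑ k ∈ Finset.range s,
    Finsupp.single (n + (s - k)) (delCoeff q k • d k ((σ⁻¹ ^ k) (p n)))
  have hsum : ∀ {α : Type} (t : Finset α) (f : α → ℕ →₀ R),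
      ((∑ i ∈ t, f i).sum fun n r => θ r * x ^ n) =
        ∑ i ∈ t, (f i).sum fun n r => θ r * x ^ n := by
    intro α t f
    rw [Finsupp.sum_finsetSum_index]
    · simp
    · intro a b c; rw [map_add, add_mul]
  have hb : (b.sum fun n r => θ r * x ^ n) = 0 := by
    have h0 : (p.sum fun n r => deletion q σ d θ x r * x ^ n) * x ^ s = 0 := by rw [hp, zero_mul]
    rw [← h0]
    simp only [b]
    rw [hsum, Finsupp.sum, Finset.sum_mul]
    refine Finset.sum_congr rfl fun n hn => ?_
    rw [hsum, mul_assoc, ← pow_add, add_comm n, pow_add, ← mul_assoc,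
      hd.deletion_mul_pow hq θ hx (hs' n hn), Finset.sum_mul]
    refine Finset.sum_congr rfl fun k _ => ?_
    rw [Finsupp.sum_single_index (by simp), map_smul, smul_mul_assoc, smul_mul_assoc, mul_assoc,
      ← pow_add, add_comm n]
  have hb0 := hθ b hb
  have hM : b (M + s) = p M := by
    simp only [b, Finsupp.finsetSum_apply]
    rw [Finset.sum_eq_single M, Finset.sum_eq_single 0]
    · simp [hd.zero]
    · intro k hk hk0
      have := Finset.mem_range.1 hk
      exact Finsupp.single_eq_of_ne (by omega)
    · intro h
      have : s = 0 := by simpa using h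
      have h2 := hs' M (p.support.max'_mem hsup) 0 (by omega)
      rw [hd.zero] at h2
      rw [h2]
      simp
    · intro n hn hnM
      refine Finset.sum_eq_zero fun k _ => Finsupp.single_eq_of_ne ?_
      have : n ≤ M := p.support.le_max' n hn
      omega
    · intro h
      exact absurd (p.support.max'_mem hsup) h
  rw [hb0] at hM
  exact Finsupp.mem_support_iff.1 (p.support.max'_mem hsup) hM.symm

end IsHigherSkewDerivation

/-! ### Initial subalgebras and skew-commuting elements -/

section Lower

variable {K : Type*} [Field K] {A : Type*} [Ring A] [Algebra K A] {X : ℕ → A} {m : ℕ}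
  {D : Type*} [Ring D] [Algebra K D]

theorem lower_induction {p : lower K X m → Prop} (gen : ∀ l : Set.Ico 1 m, p (lowerGen K X l))
    (alg : ∀ c, p (algebraMap K _ c)) (add : ∀ a b, p a → p b → p (a + b))
    (mul : ∀ a b, p a → p b → p (a * b)) (a : lower K X m) : p a := by
  obtain ⟨a, ha⟩ := a
  induction ha using Algebra.adjoin_induction with
  | mem a ha => obtain ⟨l, hl, rfl⟩ := ha; exact gen ⟨l, hl⟩
  | algebraMap c => exact alg c
  | add a b ha hb h h' => exact add _ _ h h'
  | mul a b ha hb h h' => exact mul _ _ h h'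

theorem lower_hom_ext {f g : lower K X m →ₐ[K] D}
    (h : ∀ l : Set.Ico 1 m, f (lowerGen K X l) = g (lowerGen K X l)) : f = g := by
  ext a
  induction a using lower_induction with
  | gen l => exact h l
  | alg c => rw [f.commutes, g.commutes]
  | add a b h h' => rw [map_add, map_add, h, h']
  | mul a b h h' => rw [map_mul, map_mul, h, h']

theorem mem_lower (x : ℕ → D) {i l : ℕ} (hi : i ∈ Set.Ico 1 l) : x i ∈ lower K x l :=
  Algebra.subset_adjoin (Set.mem_image_of_mem x hi)

theorem hom_mem_lower {f : lower K X m →ₐ[K] D} {y : ℕ → D}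
    (h : ∀ l : Set.Ico 1 m, f (lowerGen K X l) = y l) (a : lower K X m) : f a ∈ lower K y m := by
  induction a using lower_induction with
  | gen l => rw [h l]; exact mem_lower y l.2
  | alg c => rw [f.commutes]; exact Subalgebra.algebraMap_mem _ c
  | add a b h h' => rw [map_add]; exact add_mem h h'
  | mul a b h h' => rw [map_mul]; exact mul_mem h h'

theorem range_eq_lower {f : lower K X m →ₐ[K] D} {y : ℕ → D}
    (h : ∀ l : Set.Ico 1 m, f (lowerGen K X l) = y l) : f.range = lower K y m := by
  apply le_antisymm
  · rintro _ ⟨a, rfl⟩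
    exact hom_mem_lower h a
  · refine Algebra.adjoin_le ?_
    rintro _ ⟨l, hl, rfl⟩
    exact ⟨lowerGen K X ⟨l, hl⟩, h ⟨l, hl⟩⟩

theorem alg_eq_lower (N : ℕ) (x : ℕ → D) : alg K N x = lower K x (N + 1) := by
  have : Set.Icc 1 N = Set.Ico 1 (N + 1) := by ext; simp
  rw [alg, lower, this]

end Lower

section SkewCommute

variable {K : Type*} [Field K] {D : Type*} [DivisionRing D] [Algebra K D] {u v : D} {c : K}

theorem mul_pow_of_skewCommute (h : u * v = c • (v * u)) (n : ℕ) :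
    u * v ^ n = c ^ n • (v ^ n * u) := by
  induction n with
  | zero => simp
  | succ n ih =>
    rw [pow_succ, ← mul_assoc, ih, smul_mul_assoc, mul_assoc, h, mul_smul_comm, smul_smul,
      mul_assoc, pow_succ]

theorem pow_mul_of_skewCommute (h : u * v = c • (v * u)) (n : ℕ) :
    u ^ n * v = c ^ n • (v * u ^ n) := by
  induction n with
  | zero => simp
  | succ n ih =>
    rw [pow_succ', mul_assoc, ih, mul_smul_comm, ← mul_assoc, h, smul_mul_assoc, smul_smul,
      mul_assoc, pow_succ]

theorem mul_inv_pow_of_skewCommute (h : u * v = c • (v * u)) (hv : v ≠ 0) (n : ℕ) :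
    c ^ n • (u * (v ^ n)⁻¹) = (v ^ n)⁻¹ * u := by
  have hv' := pow_ne_zero n hv
  apply mul_left_cancel₀ hv'
  rw [mul_inv_cancel_left₀ hv', mul_smul_comm, ← mul_assoc, ← smul_mul_assoc,
    ← mul_pow_of_skewCommute h, mul_assoc, mul_inv_cancel₀ hv', mul_one]

theorem skewCommute_symm (h : u * v = c • (v * u)) (hc : c ≠ 0) : v * u = c⁻¹ • (u * v) := by
  rw [h, smul_smul, inv_mul_cancel₀ hc, one_smul]

theorem exists_pow_mul_of_skewCommute {S : Subalgebra K D} (h : u * v = c • (v * u)) (hu : u ∈ S)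
    (n : ℕ) : ∃ m : ℕ, ∃ p ∈ S, u * v ^ m = v ^ n * p :=
  ⟨n, c ^ n • u, S.smul_mem hu _, by rw [mul_pow_of_skewCommute h, mul_smul_comm]⟩

theorem powersIndependent_of_hom {R : Type*} [Ring R] [Algebra K R] (f : R →ₐ[K] D)
    {S : Subalgebra K D} (hS : f.range = S) (z : D)
    (h : ∀ p : ℕ →₀ R, (p.sum fun n r => f r * z ^ n) = 0 → p = 0) : PowersIndependent S z := by
  subst hS
  have hf : Function.Injective f := by
    rw [injective_iff_map_eq_zero]
    intro a ha
    have := h (Finsupp.single 0 a) (by simp [ha])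
    simpa using this
  let e := AlgEquiv.ofInjective f hf
  have he : ∀ r : f.range, f (e.symm r) = r := fun r =>
    congrArg Subtype.val (e.apply_symm_apply r)
  intro p hp
  have := h (p.mapRange e.symm (map_zero _)) (by
    rw [Finsupp.sum_mapRange_index (by simp)]
    simpa only [he] using hp)
  ext n
  have h2 := DFunLike.congr_fun this n
  rw [Finsupp.mapRange_apply] at h2
  have h3 := he (p n)
  rw [h2] at h3
  simpa using h3.symm

end SkewCommute

/-! ### Stages of the algorithm -/

namespace QuantumNilpotentAlgebra

variable {K : Type u} [Field K] {N : ℕ} {A : Type v} [Ring A] [Algebra K A]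
  (H : QuantumNilpotentAlgebra K N A) {D : Type*} [DivisionRing D] [Algebra K D]

theorem transport_eq {x : ℕ → D} {j : ℕ} (θ : lower K H.X j →ₐ[K] D)
    (h : ∀ l : Set.Ico 1 j, θ (lowerGen K H.X l) = x l) : H.transport x j = θ := by
  have hex : ∃ θ : lower K H.X j →ₐ[K] D, ∀ l : Set.Ico 1 j, θ (lowerGen K H.X l) = x l := ⟨θ, h⟩
  rw [transport, dif_pos hex]
  exact congrArg _ (lower_hom_ext fun l => by rw [hex.choose_spec l, h l])

theorem step_of_lt {x : ℕ → D} {j : ℕ} (θ : lower K H.X j →ₐ[K] D)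
    (h : ∀ l : Set.Ico 1 j, θ (lowerGen K H.X l) = x l) (hx : x j ≠ 0) (i : Set.Ico 1 j) :
    H.step x j i = deletion (H.q j) (H.σ j) (H.d j) θ (x j) (lowerGen K H.X i) := by
  rw [step, dif_pos ⟨hx, i.2⟩, H.transport_eq θ h]
  rfl

theorem step_of_le (x : ℕ → D) {i j : ℕ} (h : j ≤ i) : H.step x j i = x i := by
  rw [step, dif_neg fun h' => absurd h'.2.2 (by omega)]

theorem step_of_eq_zero {x : ℕ → D} {j : ℕ} (h : x j = 0) : H.step x j = x := by
  funext i
  rw [step, dif_neg fun h' => h'.1 h]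

theorem symm_pow_lowerGen {j : ℕ} (hj : j ∈ Set.Icc 2 N) (i : Set.Ico 1 j) (n : ℕ) :
    (((H.σ j)⁻¹ ^ n) (lowerGen K H.X i)) = ((H.lam j i)⁻¹ ^ n) • lowerGen K H.X i := by
  have hne : H.lam j i ≠ 0 :=
    H.lam_ne_zero j ⟨by have := hj.1; omega, hj.2⟩ i ⟨i.2.1, (i.2.2.trans_le hj.2).le⟩
  induction n with
  | zero => simp
  | succ n ih =>
    rw [pow_succ', AlgEquiv.mul_apply, ih, map_smul]
    have h1 : (H.σ j)⁻¹ (lowerGen K H.X i) = (H.lam j i)⁻¹ • lowerGen K H.X i := by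
      have h2 : (H.σ j)⁻¹ (H.σ j (lowerGen K H.X i)) = lowerGen K H.X i :=
        (H.σ j).symm_apply_apply _
      rw [H.σ_gen j hj, map_smul] at h2
      rw [← h2, smul_smul, inv_mul_cancel₀ hne, one_smul, h2]
    rw [h1, smul_smul, pow_succ]

/-- The sequence `x` looks like `(X_1^{(m)}, …, X_N^{(m)})`: the first entries generate a copy of
`A_{m-1}`, and the others form an iterated skew polynomial extension without derivations. -/
structure IsStage (x : ℕ → D) (m : ℕ) (θ : lower K H.X m →ₐ[K] D) : Prop where
  map_gen : ∀ l : Set.Ico 1 m, θ (lowerGen K H.X l) = x l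
  inj : Function.Injective θ
  comm : ∀ l ∈ Set.Ico m (N + 1), ∀ i ∈ Set.Ico 1 l, x l * x i = H.lam l i • (x i * x l)
  indep : ∀ l ∈ Set.Ico m (N + 1), PowersIndependent (lower K x l) (x l)

namespace IsStage

variable {H} {x : ℕ → D} {j : ℕ} {θ : lower K H.X (j + 1) →ₐ[K] D}

/-- The restriction to `A_{j-1}`. -/
def restr (θ : lower K H.X (j + 1) →ₐ[K] D) : lower K H.X j →ₐ[K] D :=
  θ.comp (Subalgebra.inclusion (lower_mono K H.X (Nat.le_add_right j 1)))

theorem restr_gen (h : H.IsStage x (j + 1) θ) (l : Set.Ico 1 j) :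
    restr θ (lowerGen K H.X l) = x l :=
  h.map_gen ⟨l, l.2.1, l.2.2.trans j.lt_succ_self⟩

theorem restr_comm (h : H.IsStage x (j + 1) θ) (hj : j ∈ Set.Icc 2 N) (a : lower K H.X j) :
    x j * restr θ a = restr θ (H.σ j a) * x j + restr θ (H.δ j a) := by
  have h1 : j ∈ Set.Icc 1 N := ⟨by have := hj.1; omega, hj.2⟩
  let ι := Subalgebra.inclusion (lower_mono K H.X (Nat.le_add_right j 1))
  have hι : ∀ a, ((ι a : lower K H.X (j + 1)) : A) = a := fun a =>
    Subalgebra.coe_inclusion _ a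
  let y : lower K H.X (j + 1) := lowerGen K H.X ⟨j, h1.1, j.lt_succ_self⟩
  have hy : (y : A) = H.X j := rfl
  have hg : θ y = x j := h.map_gen ⟨j, h1.1, j.lt_succ_self⟩
  have e : y * ι a = ι (H.σ j a) * y + ι (H.δ j a) := by
    apply Subtype.ext
    rw [Subalgebra.coe_mul, Subalgebra.coe_add, Subalgebra.coe_mul, hι, hι, hι, hy]
    exact (H.ore j h1).comm a
  have e' := congrArg θ e
  rw [map_add, map_mul, map_mul, hg] at e'
  exact e'

/-- Injectivity of `θ` transfers the freeness of the `j`-th Ore extension to the stage. -/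
theorem restr_independent (h : H.IsStage x (j + 1) θ) (hj : j ∈ Set.Icc 2 N)
    (p : ℕ →₀ lower K H.X j) (hp : (p.sum fun n r => restr θ r * x j ^ n) = 0) : p = 0 := by
  have h1 : j ∈ Set.Icc 1 N := ⟨by have := hj.1; omega, hj.2⟩
  let ι := Subalgebra.inclusion (lower_mono K H.X (Nat.le_add_right j 1))
  have hι : ∀ a, ((ι a : lower K H.X (j + 1)) : A) = a := fun a =>
    Subalgebra.coe_inclusion _ a
  let y : lower K H.X (j + 1) := lowerGen K H.X ⟨j, h1.1, j.lt_succ_self⟩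
  have hy : (y : A) = H.X j := rfl
  have hg : θ y = x j := h.map_gen ⟨j, h1.1, j.lt_succ_self⟩
  have hr : ∀ r, restr θ r = θ (ι r) := fun r => rfl
  have e : ∑ n ∈ p.support, ι (p n) * y ^ n = 0 := by
    apply h.inj
    rw [map_sum, map_zero, ← hp, Finsupp.sum]
    exact Finset.sum_congr rfl fun n _ => by rw [map_mul, map_pow, hg, hr]
  have e' : (p.sum fun n r => (r : A) * H.X j ^ n) = 0 := by
    have := congrArg (Subalgebra.val _) e
    rw [map_sum, map_zero] at this
    rw [Finsupp.sum, ← this]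
    exact Finset.sum_congr rfl fun n _ => by
      rw [map_mul, map_pow, Subalgebra.val_apply, Subalgebra.val_apply, hy, hι]
  exact ((H.ore j h1).basis 0 (zero_mem _)).unique e'.symm Finsupp.sum_zero_index.symm

theorem ne_zero (h : H.IsStage x (j + 1) θ) (hj : j ∈ Set.Icc 2 N) : x j ≠ 0 := by
  have := H.nontrivial
  intro h0
  have := h.restr_independent hj (Finsupp.single 1 1) (by simp [h0])
  simp at this

theorem isOrePowers (h : H.IsStage x (j + 1) θ) (hj : j ∈ Set.Icc 2 N) {l : ℕ}
    (hl : l ∈ Set.Ioc j (N + 1)) : IsOrePowers (lower K x l) (x j) := by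
  have hj1 : 1 ≤ j := by have := hj.1; omega
  refine isOrePowers_adjoin (mem_lower x ⟨hj1, hl.1⟩) ?_
  rintro _ ⟨i, hi, rfl⟩ n
  rcases lt_trichotomy i j with hij | rfl | hij
  · have := (H.higher j hj).exists_mul_pow_eq (H.q_ne_zero j hj) (restr θ) (h.restr_comm hj)
      (S := lower K x l) (mem_lower x ⟨hj1, hl.1⟩)
      (fun a => lower_mono K x hl.1.le (hom_mem_lower h.restr_gen a))
      (lowerGen K H.X ⟨i, hi.1, hij⟩) n
    rwa [h.restr_gen] at this
  · exact ⟨n, x i, mem_lower x hi, by rw [← pow_succ, pow_succ']⟩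
  · exact exists_pow_mul_of_skewCommute
      (h.comm i ⟨hij, hi.2.trans_le hl.2⟩ j ⟨hj1, hij⟩) (mem_lower x hi) n

/-- If `σ_l` maps `b` to `b'` then `x_l b = b' x_l`. -/
theorem comm_restr (h : H.IsStage x (j + 1) θ) {l : ℕ} (hl : l ∈ Set.Icc 2 N) (hjl : j < l)
    (b b' : lower K H.X j)
    (hb : H.σ l (Subalgebra.inclusion (lower_mono K H.X hjl.le) b) =
      Subalgebra.inclusion (lower_mono K H.X hjl.le) b') :
    x l * restr θ b = restr θ b' * x l := by
  -- The induction must itself produce the image under `σ_l`, since that image being in `A_{j-1}` is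
  -- part of the claim.
  have key : ∀ b : lower K H.X j, ∃ b' : lower K H.X j,
      H.σ l (Subalgebra.inclusion (lower_mono K H.X hjl.le) b) =
        Subalgebra.inclusion (lower_mono K H.X hjl.le) b' ∧
      x l * restr θ b = restr θ b' * x l := by
    intro b
    induction b using lower_induction with
    | gen i =>
      refine ⟨H.lam l i • lowerGen K H.X i, ?_, ?_⟩
      · exact H.σ_gen l hl ⟨i, i.2.1, i.2.2.trans hjl⟩
      · rw [map_smul, h.restr_gen, smul_mul_assoc]
        exact h.comm l ⟨hjl, Nat.lt_succ_of_le hl.2⟩ i ⟨i.2.1, i.2.2.trans hjl⟩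
    | alg c =>
      refine ⟨algebraMap K _ c, ?_, ?_⟩
      · rw [AlgHom.commutes, AlgEquiv.commutes]
      · rw [AlgHom.commutes, Algebra.commutes]
    | add a b ha hb =>
      obtain ⟨a', h1, h2⟩ := ha
      obtain ⟨b', h3, h4⟩ := hb
      exact ⟨a' + b', by simp only [map_add, h1, h3], by
        rw [map_add, mul_add, h2, h4, map_add, add_mul]⟩
    | mul a b ha hb =>
      obtain ⟨a', h1, h2⟩ := ha
      obtain ⟨b', h3, h4⟩ := hb
      exact ⟨a' * b', by simp only [map_mul, h1, h3], by
        rw [map_mul, ← mul_assoc, h2, mul_assoc, h4, map_mul, mul_assoc]⟩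
  obtain ⟨b'', h1, h2⟩ := key b
  rw [hb] at h1
  rw [h2, Subalgebra.inclusion_injective _ h1]

/-- Every summand of the deletion formula has the same weight for `x_l`: the factor `λ_{l,j}^n` from
`σ_l d_{j,n}` cancels against the one from moving `x_l` past `x_j^{-n}`. -/
theorem comm_step (h : H.IsStage x (j + 1) θ) (hj : j ∈ Set.Icc 2 N) {l : ℕ}
    (hl : l ∈ Set.Icc 2 N) (hjl : j < l) (i : Set.Ico 1 j) :
    x l * H.step x j i = H.lam l i • (H.step x j i * x l) := by
  have hd := H.higher j hj
  have hx := h.ne_zero hj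
  obtain ⟨M, hM⟩ := hd.locallyNilpotent (lowerGen K H.X i)
  rw [H.step_of_lt (restr θ) h.restr_gen hx, hd.deletion_eq_sum (H.q_ne_zero j hj) _ _ hM,
    Finset.mul_sum, Finset.sum_mul, Finset.smul_sum]
  refine Finset.sum_congr rfl fun n _ => ?_
  have hlj : H.lam l j ≠ 0 := H.lam_ne_zero l ⟨by have := hl.1; omega, hl.2⟩ j
    ⟨by have := hj.1; omega, hj.2⟩
  have hcj : x l * x j = H.lam l j • (x j * x l) :=
    h.comm l ⟨hjl, Nat.lt_succ_of_le hl.2⟩ j ⟨by have := hj.1; omega, hjl⟩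
  let a : lower K H.X j := ((H.σ j)⁻¹ ^ n) (lowerGen K H.X i)
  have ha : a = ((H.lam j i)⁻¹ ^ n) • lowerGen K H.X i := H.symm_pow_lowerGen hj i n
  have hσ : H.σ l (Subalgebra.inclusion (lower_mono K H.X hjl.le) a) =
      Subalgebra.inclusion (lower_mono K H.X hjl.le) (H.lam l i • a) := by
    have := H.σ_gen l hl ⟨i, i.2.1, i.2.2.trans hjl⟩
    rw [ha, map_smul, map_smul, smul_comm, map_smul, map_smul]
    congr 1
  have hσd := H.σ_d j hj l hl hjl n a _ hσ
  rw [← map_smul] at hσd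
  have hc := h.comm_restr hl hjl _ _ hσd
  rw [map_smul, map_smul, map_smul] at hc
  change x l * (_ • (restr θ (H.d j n a) * _)) = _ • (_ • (restr θ (H.d j n a) * _) * x l)
  rw [mul_smul_comm, ← mul_assoc, hc, smul_mul_assoc, smul_mul_assoc, smul_mul_assoc,
    smul_mul_assoc, mul_assoc, smul_mul_assoc, mul_assoc, ← mul_inv_pow_of_skewCommute hcj hx,
    mul_smul_comm, smul_comm (H.lam l i), smul_comm (H.lam l i)]

end IsStage

end QuantumNilpotentAlgebra

namespace QuantumNilpotentAlgebra

variable {K : Type u} [Field K] {N : ℕ} {A : Type v} [Ring A] [Algebra K A]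
  {H : QuantumNilpotentAlgebra K N A} {D : Type*} [DivisionRing D] [Algebra K D]

namespace IsStage

variable {x : ℕ → D} {j : ℕ} {θ : lower K H.X (j + 1) →ₐ[K] D}

/-- One half of the equality of the localizations before and after the step;
`exists_mul_pow_mem_step` is the other half. -/
theorem exists_step_mul_pow_mem (h : H.IsStage x (j + 1) θ) (hj : j ∈ Set.Icc 2 N) {l : ℕ}
    (hl : l ∈ Set.Ioc j (N + 1)) :
    ∀ u ∈ lower K (H.step x j) l, ∃ n : ℕ, u * x j ^ n ∈ lower K x l := by
  have hj1 : 1 ≤ j := by have := hj.1; omega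
  have hxl := mem_lower (K := K) x ⟨hj1, hl.1⟩
  refine (h.isOrePowers hj hl).exists_mul_pow_mem hxl ?_
  rintro _ ⟨i, hi, rfl⟩
  rcases lt_or_ge i j with hij | hij
  · rw [H.step_of_lt (restr θ) h.restr_gen (h.ne_zero hj) ⟨i, hi.1, hij⟩]
    exact (H.higher j hj).exists_deletion_mul_pow_mem (H.q_ne_zero j hj) (restr θ) (h.ne_zero hj)
      hxl (fun a => lower_mono K x hl.1.le (hom_mem_lower h.restr_gen a)) _
  · rw [H.step_of_le x hij]
    exact ⟨0, by rw [pow_zero, mul_one]; exact mem_lower x hi⟩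

/-- Deleting the `j`-th derivation. -/
theorem exists_step (h : H.IsStage x (j + 1) θ) (hj : j ∈ Set.Icc 2 N) :
    ∃ φ : lower K H.X j →ₐ[K] D, H.IsStage (H.step x j) j φ ∧
      (∀ a, φ a = deletion (H.q j) (H.σ j) (H.d j) (restr θ) (x j) a) := by
  have hj1 : 1 ≤ j := by have := hj.1; omega
  have hx := h.ne_zero hj
  have hd := H.higher j hj
  have hq := H.q_ne_zero j hj
  obtain ⟨φ, hφ⟩ := hd.exists_deletionHom hq (H.q_ne_one j hj) (restr θ) hx (h.restr_comm hj)
  have hgen : ∀ l : Set.Ico 1 j, φ (lowerGen K H.X l) = H.step x j l := fun l => by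
    rw [hφ, H.step_of_lt (restr θ) h.restr_gen hx]
  have hyj : H.step x j j = x j := H.step_of_le x le_rfl
  have hind : ∀ p : ℕ →₀ lower K H.X j, (p.sum fun n r => φ r * x j ^ n) = 0 → p = 0 := by
    intro p hp
    simp only [hφ] at hp
    exact hd.deletion_independent hq (restr θ) hx (h.restr_independent hj) p hp
  refine ⟨φ, ⟨hgen, ?_, ?_, ?_⟩, hφ⟩
  · rw [injective_iff_map_eq_zero]
    intro a ha
    have := hind (Finsupp.single 0 a) (by simp [ha])
    simpa using this
  · intro l hl i hi
    have hlN : l ≤ N := Nat.lt_succ_iff.1 hl.2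
    rw [H.step_of_le x hl.1]
    rcases eq_or_lt_of_le hl.1 with rfl | hjl
    · have := hd.mul_deletion hq (H.q_ne_one j hj) (restr θ) hx (h.restr_comm hj)
        (lowerGen K H.X ⟨i, hi⟩)
      rw [← hφ, ← hφ, H.σ_gen j hj, map_smul, hgen ⟨i, hi⟩, smul_mul_assoc] at this
      exact this
    · rcases lt_or_ge i j with hij | hij
      · exact h.comm_step hj ⟨by have := hj.1; omega, hlN⟩ hjl ⟨i, hi.1, hij⟩
      · rw [H.step_of_le x hij]
        exact h.comm l ⟨hjl, hl.2⟩ i hi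
  · intro l hl
    have hlN : l ≤ N := Nat.lt_succ_iff.1 hl.2
    rw [H.step_of_le x hl.1]
    rcases eq_or_lt_of_le hl.1 with rfl | hjl
    · exact powersIndependent_of_hom φ (range_eq_lower hgen) (x j) hind
    · have hlj : H.lam l j ≠ 0 := H.lam_ne_zero l ⟨by omega, hlN⟩ j ⟨hj1, hj.2⟩
      have hc := h.comm l ⟨hjl, hl.2⟩ j ⟨hj1, hjl⟩
      intro p hp
      -- Multiplying a relation on the right by `x_j ^ s` brings its coefficients back to the old
      -- algebra. Carrying `x_j ^ s` past `x_l ^ n` costs the scalar recorded in `b`, which is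
      -- nonzero, so old independence suffices.
      obtain ⟨s, hs⟩ := exists_sum_mul_pow_mem (S := lower K x l) (mem_lower x ⟨hj1, hjl⟩)
        p.support (fun n => (p n : D)) fun n _ =>
          h.exists_step_mul_pow_mem hj ⟨hjl, hl.2.le⟩ _ (p n).2
      have hs' : ∀ n, (p n : D) * x j ^ s ∈ lower K x l := by
        intro n
        by_cases hn : n ∈ p.support
        · exact hs n hn
        · rw [Finsupp.notMem_support_iff.1 hn]
          simp
      let b : ℕ →₀ lower K x l := Finsupp.onFinset p.support
        (fun n => (H.lam l j ^ s) ^ n • ⟨(p n : D) * x j ^ s, hs' n⟩) (by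
          intro n hn
          rw [Finsupp.mem_support_iff]
          rintro h0
          apply hn
          apply Subtype.ext
          simp [h0])
      have hb : (b.sum fun n r => (r : D) * x l ^ n) = 0 := by
        have h0 : (p.sum fun n r => (r : D) * x l ^ n) * x j ^ s = 0 := by rw [hp, zero_mul]
        rw [← h0, Finsupp.sum, Finsupp.sum, Finset.sum_mul,
          Finset.sum_subset (Finsupp.support_onFinset_subset : b.support ⊆ p.support)]
        · refine Finset.sum_congr rfl fun n _ => ?_
          have hbn : ((b n : lower K x l) : D) = (H.lam l j ^ s) ^ n • ((p n : D) * x j ^ s) := rfl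
          rw [hbn, mul_assoc (p n : D),
            pow_mul_of_skewCommute (mul_pow_of_skewCommute hc s) n, mul_smul_comm, smul_mul_assoc,
            mul_assoc]
        · intro n _ hn
          rw [Finsupp.notMem_support_iff.1 hn]
          simp
      have hb0 := h.indep l ⟨hjl, hl.2⟩ b hb
      ext n
      have hbn : ((b n : lower K x l) : D) = (H.lam l j ^ s) ^ n • ((p n : D) * x j ^ s) := rfl
      rw [hb0] at hbn
      have h1 := (smul_eq_zero.1 hbn.symm).resolve_left (pow_ne_zero _ (pow_ne_zero _ hlj))
      have h2 := (mul_eq_zero.1 h1).resolve_right (pow_ne_zero _ hx)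
      simpa using h2

/-- Distinct entries with one index at least `m` commute up to the prescribed scalars. -/
theorem comm_all {m : ℕ} {φ : lower K H.X m →ₐ[K] D} (h : H.IsStage x m φ) {l i : ℕ}
    (hl : l ∈ Set.Icc 1 N) (hi : i ∈ Set.Icc 1 N) (hli : l ≠ i) (hm : m ≤ max l i) :
    x l * x i = H.lam l i • (x i * x l) := by
  rcases lt_or_gt_of_ne hli with hlt | hlt
  · have := h.comm i ⟨by omega, by have := hi.2; omega⟩ l ⟨hl.1, hlt⟩
    rw [H.lam_inv l hl i hi]
    exact skewCommute_symm this (H.lam_ne_zero i hi l hl)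
  · exact h.comm l ⟨by omega, by have := hl.2; omega⟩ i ⟨hi.1, hlt⟩

theorem exists_mul_pow_mem_step (h : H.IsStage x (j + 1) θ) (hj : j ∈ Set.Icc 2 N) :
    ∀ u ∈ lower K x (N + 1), ∃ n : ℕ, u * x j ^ n ∈ lower K (H.step x j) (N + 1) := by
  have hj1 : 1 ≤ j := by have := hj.1; omega
  obtain ⟨φ, hφ, hφd⟩ := h.exists_step hj
  have hx := h.ne_zero hj
  have hyj : H.step x j j = x j := H.step_of_le x le_rfl
  have hxl : x j ∈ lower K (H.step x j) (N + 1) := by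
    rw [← hyj]
    exact mem_lower _ ⟨hj1, Nat.lt_succ_of_le hj.2⟩
  have hore : IsOrePowers (lower K (H.step x j) (N + 1)) (x j) := by
    refine isOrePowers_adjoin hxl ?_
    rintro _ ⟨i, hi, rfl⟩ n
    by_cases hij : i = j
    · subst hij
      rw [hyj]
      exact ⟨n, x i, hxl, by rw [← pow_succ, pow_succ']⟩
    · have := hφ.comm_all (l := i) (i := j) ⟨hi.1, Nat.lt_succ_iff.1 hi.2⟩ ⟨hj1, hj.2⟩ hij
        (le_max_right _ _)
      rw [hyj] at this
      exact exists_pow_mul_of_skewCommute this (mem_lower _ hi) n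
  refine hore.exists_mul_pow_mem hxl ?_
  rintro _ ⟨i, hi, rfl⟩
  rcases lt_or_ge i j with hij | hij
  · have := (H.higher j hj).exists_mul_pow_mem_of_deletion (H.q_ne_zero j hj) (restr θ) hx hxl
      (fun a => by
        rw [← hφd]
        exact lower_mono K _ (by have := hj.2; omega) (hom_mem_lower hφ.map_gen a))
      (lowerGen K H.X ⟨i, hi.1, hij⟩)
    rwa [h.restr_gen] at this
  · rw [← H.step_of_le x hij]
    exact ⟨0, by rw [pow_zero, mul_one]; exact mem_lower _ hi⟩

/-- Homomorphisms defined on an initial piece of a stage extend to the whole algebra. -/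
theorem exists_hom_lower {m : ℕ} {φ : lower K H.X m →ₐ[K] D} (h : H.IsStage x m φ)
    {Q : Type*} [Ring Q] [Algebra K Q] (ψ : lower K H.X m →ₐ[K] Q) (z : ℕ → Q)
    (hψ : ∀ l : Set.Ico 1 m, ψ (lowerGen K H.X l) = z l)
    (hz : ∀ l ∈ Set.Ico m (N + 1), ∀ i ∈ Set.Ico 1 l, z l * z i = H.lam l i • (z i * z l))
    {k : ℕ} (hk : k ∈ Set.Icc m (N + 1)) :
    ∃ g : lower K x k →ₐ[K] Q, ∀ l : Set.Ico 1 k, g (lowerGen K x l) = z l := by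
  obtain ⟨hmk, hkN⟩ := hk
  induction k, hmk using Nat.le_induction with
  | base =>
    let e := AlgEquiv.ofInjective φ h.inj
    have hle : lower K x m ≤ φ.range := (range_eq_lower h.map_gen).ge
    refine ⟨(ψ.comp e.symm.toAlgHom).comp (Subalgebra.inclusion hle), fun l => ?_⟩
    rw [← hψ l]
    have : Subalgebra.inclusion hle (lowerGen K x l) = e (lowerGen K H.X l) :=
      Subtype.ext (h.map_gen l).symm
    rw [AlgHom.comp_apply, this]
    exact congrArg ψ (e.symm_apply_apply _)
  | succ k hmk ih =>
    obtain ⟨g, hg⟩ := ih (by omega)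
    have hk' : k ∈ Set.Ico m (N + 1) := ⟨hmk, hkN⟩
    have hind := h.indep k hk'
    have hx := hind.ne_zero
    have hconj : ∀ r : lower K x k, ∃ r' : lower K x k, (r' : D) * x k = x k * r ∧
        z k * g r = g r' * z k := by
      intro r
      induction r using lower_induction with
      | gen i =>
        refine ⟨H.lam k i • lowerGen K x i, ?_, ?_⟩
        · rw [Subalgebra.coe_smul, smul_mul_assoc]
          exact (h.comm k hk' i i.2).symm
        · rw [map_smul, hg, smul_mul_assoc]
          exact hz k hk' i i.2
      | alg c =>
        exact ⟨algebraMap K _ c, Algebra.commutes c (x k), by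
          rw [AlgHom.commutes, Algebra.commutes]⟩
      | add a b ha hb =>
        obtain ⟨a', h1, h2⟩ := ha
        obtain ⟨b', h3, h4⟩ := hb
        refine ⟨a' + b', ?_, ?_⟩
        · rw [Subalgebra.coe_add, Subalgebra.coe_add, add_mul, mul_add, h1, h3]
        · rw [map_add, map_add, add_mul, mul_add, h2, h4]
      | mul a b ha hb =>
        obtain ⟨a', h1, h2⟩ := ha
        obtain ⟨b', h3, h4⟩ := hb
        refine ⟨a' * b', ?_, ?_⟩
        · rw [Subalgebra.coe_mul, Subalgebra.coe_mul, mul_assoc, h3, ← mul_assoc, h1, mul_assoc]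
        · rw [map_mul, map_mul, ← mul_assoc, h2, mul_assoc, h4, mul_assoc]
    obtain ⟨g', h1, h2⟩ := exists_algHom_of_powersIndependent hind
      (fun r hr => by
        obtain ⟨r', e, -⟩ := hconj ⟨r, hr⟩
        rw [← e, mul_inv_cancel_right₀ hx]
        exact r'.2)
      g (z k)
      (fun r r' e => by
        obtain ⟨r'', e', e''⟩ := hconj r
        have : r' = r'' := Subtype.ext (mul_right_cancel₀ hx (e.trans e'.symm))
        rw [this, e''])
      (lower K x (k + 1)) (by
        refine Algebra.adjoin_mono ?_
        rintro _ ⟨i, hi, rfl⟩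
        rcases eq_or_lt_of_le (Nat.lt_succ_iff.1 hi.2) with rfl | hik
        · exact Or.inr rfl
        · exact Or.inl (mem_lower x ⟨hi.1, hik⟩))
    refine ⟨g', fun l => ?_⟩
    rcases eq_or_lt_of_le (Nat.lt_succ_iff.1 l.2.2) with hlk | hlk
    · rw [h2 _ (congrArg x hlk), hlk]
    · rw [h1 (lowerGen K x l) (lowerGen K x ⟨l, l.2.1, hlk⟩) rfl, hg]

end IsStage

end QuantumNilpotentAlgebra

/-! ### Quotients, and one step modulo an ideal -/

section Quotients

variable {K : Type*} [Field K] {R Q : Type*} [Ring R] [Algebra K R] [Ring Q] [Algebra K Q]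

theorem quoMk_eq_zero (P : TwoSidedIdeal R) (a : R) : quoMk K P a = 0 ↔ a ∈ P := by
  rw [TwoSidedIdeal.mem_iff]
  exact RingCon.eq P.ringCon

theorem quoMk_surjective (P : TwoSidedIdeal R) : Function.Surjective (quoMk K P) :=
  RingCon.mkₐ_surjective P.ringCon

theorem exists_quo_lift (P : TwoSidedIdeal R) (f : R →ₐ[K] Q) (h : ∀ a ∈ P, f a = 0) :
    ∃ g : Quo P →ₐ[K] Q, ∀ a, g (quoMk K P a) = f a := by
  refine ⟨RingCon.liftₐ P.ringCon f ?_, fun a => RingCon.liftₐ_mk _ _ _ _⟩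
  intro a b hab
  have := h _ ((P.rel_iff a b).1 hab)
  rw [map_sub, sub_eq_zero] at this
  exact this

/-- The sets spanned in `psiStep` and `psiIter` turn out to be kernels already, so taking the span
adds nothing. -/
theorem mem_span_of_eq_ker (f : R →ₐ[K] Q) {s : Set R} (hs : ∀ a, a ∈ s ↔ f a = 0) (a : R) :
    a ∈ TwoSidedIdeal.span s ↔ f a = 0 := by
  constructor
  · intro ha
    have : TwoSidedIdeal.span s ≤ TwoSidedIdeal.ker f :=
      TwoSidedIdeal.span_le.2 fun b hb => (TwoSidedIdeal.mem_ker f).2 ((hs b).1 hb)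
    exact (TwoSidedIdeal.mem_ker f).1 (this ha)
  · exact fun ha => TwoSidedIdeal.subset_span ((hs a).2 ha)

end Quotients

theorem alg_hom_ext {K : Type*} [Field K] {N : ℕ} {D Q : Type*} [Ring D] [Algebra K D] [Ring Q]
    [Algebra K Q] {x : ℕ → D} {f g : alg K N x →ₐ[K] Q}
    (h : ∀ i : Set.Icc 1 N, f (gen K x i) = g (gen K x i)) : f = g := by
  refine AlgHom.adjoin_ext ?_
  rintro _ ⟨i, hi, rfl⟩
  exact h ⟨i, hi⟩

namespace QuantumNilpotentAlgebra

variable {K : Type u} [Field K] {N : ℕ} {A : Type v} [Ring A] [Algebra K A]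
  {H : QuantumNilpotentAlgebra K N A} {F : Type*} [DivisionRing F] [Algebra K F]
  {G : Type*} [DivisionRing G] [Algebra K G] {x : ℕ → F} {z : ℕ → G} {j : ℕ}
  {θ : lower K H.X (j + 1) →ₐ[K] F}

namespace IsStage

/-- As `x_j` goes to a unit, `f` extends to fractions with denominators `x_j ^ n`, which contain the
new algebra. It respects the step because the deletion formula, cleared of denominators, is an
identity in the old algebra. -/
theorem exists_hom_of_ne_zero (h : H.IsStage x (j + 1) θ) (hj : j ∈ Set.Icc 2 N)
    (f : alg K N x →ₐ[K] G) (hf : ∀ i : Set.Icc 1 N, f (gen K x i) = z i) (hz : z j ≠ 0) :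
    ∃ f' : alg K N (H.step x j) →ₐ[K] G,
      (∀ i : Set.Icc 1 N, f' (gen K (H.step x j) i) = H.step z j i) ∧
      ∀ (u : alg K N (H.step x j)) (p : alg K N x) (n : ℕ), (u : F) * x j ^ n = p →
        f' u * z j ^ n = f p := by
  have hj1 : 1 ≤ j := by have := hj.1; omega
  have hx := h.ne_zero hj
  let X : alg K N x := gen K x ⟨j, hj1, hj.2⟩
  have hX : (X : F) = x j := rfl
  have hfX : f X = z j := hf _
  have hNj : N + 1 ∈ Set.Ioc j (N + 1) := ⟨Nat.lt_succ_of_le hj.2, le_rfl⟩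
  have hore := h.isOrePowers hj hNj
  have hloc := h.exists_step_mul_pow_mem hj hNj
  rw [← alg_eq_lower] at hore hloc
  rw [← alg_eq_lower] at hloc
  obtain ⟨f', hf'⟩ := exists_algHom_of_fractions (alg K N x).val Subtype.val_injective f
    (Submonoid.powers X)
    (by
      rintro r _ ⟨n, rfl⟩
      obtain ⟨m, p, hp, e⟩ := hore r r.2 n
      exact ⟨⟨p, hp⟩, X ^ m, ⟨m, rfl⟩, Subtype.ext e⟩)
    (by
      rintro _ ⟨n, rfl⟩
      simp only [map_pow, hfX]
      exact (pow_ne_zero n hz).isUnit)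
    (alg K N (H.step x j))
    (by
      intro u hu
      obtain ⟨n, hn⟩ := hloc u hu
      exact ⟨X ^ n, ⟨n, rfl⟩, ⟨_, hn⟩, rfl⟩)
  have hcomp : ∀ (u : alg K N (H.step x j)) (p : alg K N x) (n : ℕ), (u : F) * x j ^ n = p →
      f' u * z j ^ n = f p := by
    intro u p n e
    have := hf' u p (X ^ n) ⟨n, rfl⟩ e
    rwa [map_pow, hfX] at this
  refine ⟨f', fun i => ?_, hcomp⟩
  rcases lt_or_ge i.1 j with hij | hij
  · have hmem : ∀ a, restr θ a ∈ alg K N x := fun a => by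
      rw [alg_eq_lower]
      exact lower_mono K x hNj.1.le (hom_mem_lower h.restr_gen a)
    let r := (restr θ).codRestrict (alg K N x) hmem
    have hd := H.higher j hj
    have hq := H.q_ne_zero j hj
    let I : Set.Ico 1 j := ⟨i, i.2.1, hij⟩
    obtain ⟨M, hM⟩ := hd.locallyNilpotent (lowerGen K H.X I)
    have e1 : H.step x j i = deletion (H.q j) (H.σ j) (H.d j) (restr θ) (x j) (lowerGen K H.X I) :=
      H.step_of_lt (restr θ) h.restr_gen hx I
    have hgr : ∀ l : Set.Ico 1 j, f.comp r (lowerGen K H.X l) = z l := by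
      intro l
      rw [← hf ⟨l, l.2.1, l.2.2.le.trans hj.2⟩]
      exact congrArg f (Subtype.ext (h.restr_gen l))
    -- The map `f.comp r` shows that the homomorphism sought by `transport` exists in the quotient
    -- too.
    have e2 : H.step z j i = deletion (H.q j) (H.σ j) (H.d j) (f.comp r) (z j)
        (lowerGen K H.X I) := H.step_of_lt (f.comp r) hgr hz I
    have h1 := hd.deletion_mul_pow hq (restr θ) hx hM
    have h2 := hd.deletion_mul_pow hq (f.comp r) hz hM
    rw [← e1] at h1
    rw [← e2] at h2
    let p : alg K N x := ∑ n ∈ Finset.range M,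
      delCoeff (H.q j) n • (r (H.d j n (((H.σ j)⁻¹ ^ n) (lowerGen K H.X I))) * X ^ (M - n))
    have hp : (p : F) = H.step x j i * x j ^ M := by
      rw [h1]
      simp only [p, AddSubmonoidClass.coe_finsetSum]
      rfl
    have hfp : f p = H.step z j i * z j ^ M := by
      rw [h2]
      simp only [p, map_sum, map_smul, map_mul, map_pow, hfX]
      rfl
    have := hcomp (gen K (H.step x j) i) p M hp.symm
    rw [hfp] at this
    exact mul_right_cancel₀ (pow_ne_zero M hz) this
  · have := hcomp (gen K (H.step x j) i) (gen K x i) 0 (by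
      rw [pow_zero, mul_one]
      exact H.step_of_le x hij)
    rw [pow_zero, mul_one, hf] at this
    rw [this, H.step_of_le z hij]

/-- The new algebra is an iterated skew polynomial extension of a copy of `A_{j-1}`, so only
commutation relations need checking. Those of `x_j` hold because its image is zero; the later ones
already held before the step. -/
theorem exists_hom_of_eq_zero (h : H.IsStage x (j + 1) θ) (hj : j ∈ Set.Icc 2 N)
    (Q : Type*) [Ring Q] [Algebra K Q] (f : alg K N x →ₐ[K] Q)
    (hf : f (gen K x ⟨j, le_trans one_le_two hj.1, hj.2⟩) = 0) :
    ∃ g : alg K N (H.step x j) →ₐ[K] Q,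
      ∀ i : Set.Icc 1 N, g (gen K (H.step x j) i) = f (gen K x i) := by
  classical
  obtain ⟨φ, hφ, -⟩ := h.exists_step hj
  have hNj : j ≤ N + 1 := by have := hj.2; omega
  have hmem : ∀ a, restr θ a ∈ alg K N x := fun a => by
    rw [alg_eq_lower]
    exact lower_mono K x hNj (hom_mem_lower h.restr_gen a)
  let r := (restr θ).codRestrict (alg K N x) hmem
  let z : ℕ → Q := fun i => if hi : i ∈ Set.Icc 1 N then f (gen K x ⟨i, hi⟩) else 0
  have hz : ∀ i : Set.Icc 1 N, z i = f (gen K x i) := fun i => dif_pos i.2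
  have hzj : z j = 0 := by rw [← hf]; exact hz ⟨j, _⟩
  obtain ⟨g, hg⟩ := hφ.exists_hom_lower (f.comp r) z
    (by
      intro l
      rw [hz ⟨l, l.2.1, l.2.2.le.trans hj.2⟩]
      exact congrArg f (Subtype.ext (h.restr_gen l)))
    (by
      intro l hl i hi
      have hlN : l ≤ N := Nat.lt_succ_iff.1 hl.2
      rcases eq_or_lt_of_le hl.1 with rfl | hjl
      · rw [hzj, zero_mul, mul_zero, smul_zero]
      · rw [hz ⟨l, hi.1.trans hi.2.le, hlN⟩, hz ⟨i, hi.1, hi.2.le.trans hlN⟩, ← map_mul,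
          ← map_mul, ← map_smul]
        exact congrArg f (Subtype.ext (h.comm l ⟨hjl, hl.2⟩ i hi)))
    (k := N + 1) ⟨hNj, le_rfl⟩
  refine ⟨g.comp (Subalgebra.inclusion (alg_eq_lower N (H.step x j)).le), fun i => ?_⟩
  rw [← hz i, ← hg ⟨i, i.2.1, Nat.lt_succ_of_le i.2.2⟩]
  rfl

/-- One step of the algorithm is compatible with passing to the quotient by a completely prime
ideal. -/
theorem exists_hom_step (h : H.IsStage x (j + 1) θ) (hj : j ∈ Set.Icc 2 N)
    (f : alg K N x →ₐ[K] G) (hf : ∀ i : Set.Icc 1 N, f (gen K x i) = z i)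
    (I : TwoSidedIdeal (alg K N x)) (hI : ∀ a, a ∈ I ↔ f a = 0) :
    ∃ f' : alg K N (H.step x j) →ₐ[K] G,
      (∀ i : Set.Icc 1 N, f' (gen K (H.step x j) i) = H.step z j i) ∧
      (∀ a, a ∈ psiStep N x (H.step x j) j I ↔ f' a = 0) ∧
      (z j ≠ 0 → ∀ (u : alg K N (H.step x j)) (p : alg K N x) (n : ℕ), (u : F) * x j ^ n = p →
        f' u * z j ^ n = f p) := by
  have hj1 : 1 ≤ j := by have := hj.1; omega
  let X : alg K N x := gen K x ⟨j, hj1, hj.2⟩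
  have hfX : f X = z j := hf _
  have hcond : (∃ p ∈ I, (p : F) = x j) ↔ z j = 0 := by
    rw [← hfX, ← hI]
    constructor
    · rintro ⟨p, hp, e⟩
      have : p = X := Subtype.ext e
      rwa [← this]
    · exact fun hX => ⟨X, hX, rfl⟩
  by_cases hz : z j = 0
  · let J : TwoSidedIdeal (alg K N x) := TwoSidedIdeal.span {b : alg K N x | (b : F) = x j}
    have hXJ : X ∈ J := TwoSidedIdeal.subset_span rfl
    have hJ : ∀ a ∈ J, f a = 0 := by
      have : J ≤ TwoSidedIdeal.ker f := TwoSidedIdeal.span_le.2 fun b hb => by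
        refine (TwoSidedIdeal.mem_ker f).2 ?_
        have : b = X := Subtype.ext hb
        rw [this, hfX, hz]
      exact fun a ha => (TwoSidedIdeal.mem_ker f).1 (this ha)
    obtain ⟨fq, hfq⟩ := exists_quo_lift J f hJ
    obtain ⟨g, hg⟩ := h.exists_hom_of_eq_zero hj (Quo J) (quoMk K J) ((quoMk_eq_zero J X).2 hXJ)
    refine ⟨fq.comp g, fun i => ?_, fun a => ?_, fun h' => absurd hz h'⟩
    · rw [AlgHom.comp_apply, hg, hfq, hf, H.step_of_eq_zero hz]
    · rw [psiStep, if_pos (hcond.2 hz)]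
      apply mem_span_of_eq_ker
      intro a
      constructor
      · rintro ⟨g', hg', p, hp, e⟩
        -- The homomorphism `g_j` is determined by generators, so the existential in `psiStep` has a
        -- single candidate.
        have : g' = g := alg_hom_ext fun i => by rw [hg', hg]
        rw [AlgHom.comp_apply, ← this, e, hfq, (hI p).1 hp]
      · intro ha
        obtain ⟨p, hp⟩ := quoMk_surjective (K := K) J (g a)
        refine ⟨g, hg, p, ?_, hp.symm⟩
        rw [hI, ← hfq, hp]
        exact ha
  · obtain ⟨f', hf', hc⟩ := h.exists_hom_of_ne_zero hj f hf hz
    refine ⟨f', hf', fun a => ?_, fun _ => hc⟩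
    rw [psiStep, if_neg (mt hcond.1 hz)]
    apply mem_span_of_eq_ker
    intro a
    have hx := h.ne_zero hj
    constructor
    · rintro ⟨p, hp, n, e⟩
      have := hc a p n (by rw [e, inv_mul_cancel_right₀ (pow_ne_zero n hx)])
      rw [(hI p).1 hp] at this
      exact (mul_eq_zero.1 this).resolve_right (pow_ne_zero n hz)
    · intro ha
      have hloc := h.exists_step_mul_pow_mem hj (l := N + 1) ⟨Nat.lt_succ_of_le hj.2, le_rfl⟩
      rw [← alg_eq_lower, ← alg_eq_lower] at hloc
      obtain ⟨n, hn⟩ := hloc a a.2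
      refine ⟨⟨_, hn⟩, ?_, n, ?_⟩
      · rw [hI, ← hc a ⟨_, hn⟩ n rfl, ha, zero_mul]
      · exact (mul_inv_cancel_right₀ (pow_ne_zero n hx) _).symm

end IsStage

end QuantumNilpotentAlgebra

theorem hom_range_eq_alg {K : Type*} [Field K] {N : ℕ} {D Q : Type*} [Ring D] [Algebra K D]
    [Ring Q] [Algebra K Q] {x : ℕ → D} {z : ℕ → Q} (f : alg K N x →ₐ[K] Q)
    (h : ∀ i : Set.Icc 1 N, f (gen K x i) = z i) : f.range = alg K N z := by
  apply le_antisymm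
  · rintro _ ⟨⟨a, ha⟩, rfl⟩
    change f ⟨a, ha⟩ ∈ alg K N z
    induction ha using Algebra.adjoin_induction with
    | mem a ha =>
      obtain ⟨l, hl, rfl⟩ := ha
      have := h ⟨l, hl⟩
      exact this ▸ Algebra.subset_adjoin (Set.mem_image_of_mem z hl)
    | algebraMap c => exact (f.commutes c).symm ▸ Subalgebra.algebraMap_mem _ c
    | add a b ha hb h h' => exact (map_add f ⟨a, ha⟩ ⟨b, hb⟩).symm ▸ add_mem h h'
    | mul a b ha hb h h' => exact (map_mul f ⟨a, ha⟩ ⟨b, hb⟩).symm ▸ mul_mem h h'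
  · refine Algebra.adjoin_le ?_
    rintro _ ⟨l, hl, rfl⟩
    exact ⟨gen K x ⟨l, hl⟩, h ⟨l, hl⟩⟩

/-! ### Comparison of right fractions -/

section Fractions

variable {K : Type*} [Field K] {G : Type*} [DivisionRing G] [Algebra K G]

/-- The right fractions with numerators in `S` and denominators in `M`. -/
def rightFractions (S : Subalgebra K G) (M : Submonoid G) : Set G :=
  {f | ∃ b ∈ S, ∃ g ∈ M, f = b * g⁻¹}

/-- Two algebras with the same localization at the powers of `z ∈ M` have the same fractions. -/
theorem rightFractions_eq {S S' : Subalgebra K G} {M : Submonoid G} (hM : M ≤ S.toSubmonoid)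
    {z : G} (hz : z ≠ 0) (hzM : z ∈ M) (hzS : z ∈ S') (h : ∀ u ∈ S, ∃ n : ℕ, u * z ^ n ∈ S')
    (h' : ∀ u ∈ S', ∃ n : ℕ, u * z ^ n ∈ S) :
    rightFractions S M = rightFractions S' (S'.toSubmonoid ⊓ M) := by
  ext f
  constructor
  · rintro ⟨b, hb, s, hs, rfl⟩
    obtain ⟨n, hn⟩ := h b hb
    obtain ⟨m, hm⟩ := h s (hM hs)
    refine ⟨b * z ^ (n + m), ?_, s * z ^ (n + m), ⟨?_, M.mul_mem hs (M.pow_mem hzM _)⟩, ?_⟩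
    -- Numerator and denominator are both multiplied by `z ^ (n + m)`, enough to bring each of them
    -- into `S'`.
    · rw [pow_add, ← mul_assoc]
      exact mul_mem hn (pow_mem hzS _)
    · rw [add_comm, pow_add, ← mul_assoc]
      exact S'.mul_mem hm (pow_mem hzS _)
    · rw [mul_inv_rev, ← mul_assoc, mul_inv_cancel_right₀ (pow_ne_zero _ hz)]
  · rintro ⟨c, hc, s, hs, rfl⟩
    obtain ⟨n, hn⟩ := h' c hc
    refine ⟨c * z ^ n, hn, s * z ^ n, M.mul_mem hs.2 (M.pow_mem hzM _), ?_⟩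
    rw [mul_inv_rev, ← mul_assoc, mul_inv_cancel_right₀ (pow_ne_zero _ hz)]

end Fractions

/-! ### The full algorithm in Frac(A) and in Frac(B) -/

namespace QuantumNilpotentAlgebra

variable {K : Type u} [Field K] {N : ℕ} {A : Type v} [Ring A] [Algebra K A]
  (H : QuantumNilpotentAlgebra K N A) {F : Type*} [DivisionRing F] [Algebra K F]
  {G : Type*} [DivisionRing G] [Algebra K G]

/-- Steps after the `k`-th are made at indices at most `N - k` and alter only entries below their
index. -/
theorem iter_eq_of_le (x : ℕ → F) {k l : ℕ} (hl : N - k ≤ l) (i : ℕ) :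
    H.iter x (k + i) l = H.iter x k l := by
  induction i with
  | zero => rfl
  | succ i ih => rw [← ih, ← add_assoc, iter, H.step_of_le _ (by omega)]

theorem adjoin_X_eq_top : Algebra.adjoin K (H.X '' Set.Icc 1 N) = ⊤ := by
  rw [← H.lower_eq_top]
  exact alg_eq_lower N H.X

theorem exists_isStage {ι : A →ₐ[K] F} (hι : Function.Injective ι) {k m : ℕ} (hk : k ≤ N - 1)
    (hm : m + k = N + 1) :
    ∃ θ : lower K H.X m →ₐ[K] F, H.IsStage (H.iter (H.genFrac ι) k) m θ := by
  induction k generalizing m with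
  | zero =>
    obtain rfl : m = N + 1 := by omega
    -- At the start the initial piece is everything, so the conditions on later variables are
    -- vacuous.
    exact ⟨ι.comp (Subalgebra.val _), fun l => rfl, hι.comp Subtype.val_injective,
      fun l hl => absurd hl.1 (not_le.2 hl.2), fun l hl => absurd hl.1 (not_le.2 hl.2)⟩
  | succ k ih =>
    obtain ⟨θ, h⟩ := ih (by omega) (m := m + 1) (by omega)
    obtain ⟨φ, hφ, -⟩ := h.exists_step ⟨by omega, by omega⟩
    have : N - k = m := by omega
    rw [iter, this]
    exact ⟨φ, hφ⟩

variable {ι : A →ₐ[K] F} (P : TwoSidedIdeal A) {κ : Quo P →ₐ[K] G}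

theorem exists_hom_genFrac (hι : Function.Injective ι) (hκ : Function.Injective κ) :
    ∃ f : alg K N (H.genFrac ι) →ₐ[K] G,
      (∀ i : Set.Icc 1 N, f (gen K (H.genFrac ι) i) = H.genQuot P κ i) ∧
      ∀ a, a ∈ TwoSidedIdeal.span {a : alg K N (H.genFrac ι) | ∃ p ∈ P, (a : F) = ι p} ↔
        f a = 0 := by
  have hle : alg K N (H.genFrac ι) ≤ ι.range := by
    refine Algebra.adjoin_le ?_
    rintro _ ⟨i, -, rfl⟩
    exact ⟨H.X i, rfl⟩
  let e := AlgEquiv.ofInjective ι hι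
  let f : alg K N (H.genFrac ι) →ₐ[K] G :=
    ((κ.comp (quoMk K P)).comp e.symm.toAlgHom).comp (Subalgebra.inclusion hle)
  have hf : ∀ (u : alg K N (H.genFrac ι)) (a : A), (u : F) = ι a → f u = κ (quoMk K P a) := by
    intro u a h
    have : Subalgebra.inclusion hle u = e a := Subtype.ext h
    simp only [f, AlgHom.comp_apply, this]
    exact congrArg _ (congrArg _ (e.symm_apply_apply a))
  refine ⟨f, fun i => hf _ _ rfl, ?_⟩
  apply mem_span_of_eq_ker
  intro u
  obtain ⟨a, ha⟩ := hle u.2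
  rw [hf u a ha.symm, map_eq_zero_iff κ hκ, quoMk_eq_zero]
  constructor
  · rintro ⟨p, hp, e⟩
    rwa [← hι (e.symm.trans ha.symm)]
  · exact fun h => ⟨a, h, ha.symm⟩

/-- `A^{(j)} / P_j` embeds in `Frac(B)`, where `P_j` is the image of `P` under the canonical
embedding. -/
theorem exists_hom_iter (hι : Function.Injective ι) (hκ : Function.Injective κ) {k : ℕ}
    (hk : k ≤ N - 1) :
    ∃ f : alg K N (H.iter (H.genFrac ι) k) →ₐ[K] G,
      (∀ i : Set.Icc 1 N, f (gen K (H.iter (H.genFrac ι) k) i) = H.iter (H.genQuot P κ) k i) ∧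
      ∀ a, a ∈ H.psiIter ι P k ↔ f a = 0 := by
  induction k with
  | zero =>
    exact H.exists_hom_genFrac P hι hκ
  | succ k ih =>
    obtain ⟨f, hf, hI⟩ := ih (by omega)
    obtain ⟨θ, h⟩ := H.exists_isStage hι (k := k) (m := N - k + 1) (by omega) (by omega)
    obtain ⟨f', h1, h2, -⟩ := h.exists_hom_step ⟨by omega, by omega⟩ f hf _ hI
    exact ⟨f', h1, h2⟩

/-- Both inclusions are proved in Frac(A), where the stage structure is available, and pushed
forward by the induced homomorphisms. -/
theorem exists_mul_pow_mem_iter (hι : Function.Injective ι) (hκ : Function.Injective κ) {k : ℕ}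
    (hk : k + 1 ≤ N - 1) (hz : H.iter (H.genQuot P κ) k (N - k) ≠ 0) :
    (∀ u ∈ alg K N (H.iter (H.genQuot P κ) (k + 1)), ∃ n : ℕ,
      u * H.iter (H.genQuot P κ) k (N - k) ^ n ∈ alg K N (H.iter (H.genQuot P κ) k)) ∧
    (∀ u ∈ alg K N (H.iter (H.genQuot P κ) k), ∃ n : ℕ,
      u * H.iter (H.genQuot P κ) k (N - k) ^ n ∈ alg K N (H.iter (H.genQuot P κ) (k + 1))) := by
  have hj : N - k ∈ Set.Icc 2 N := ⟨by omega, by omega⟩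
  obtain ⟨f, hf, hI⟩ := H.exists_hom_iter P hι hκ (k := k) (by omega)
  obtain ⟨θ, h⟩ := H.exists_isStage hι (k := k) (m := N - k + 1) (by omega) (by omega)
  obtain ⟨f', h1, -, hc⟩ := h.exists_hom_step hj f hf _ hI
  have hc := hc hz
  have hr := hom_range_eq_alg f hf
  have hr' : f'.range = alg K N (H.iter (H.genQuot P κ) (k + 1)) := hom_range_eq_alg f' h1
  rw [← hr, ← hr']
  let X := gen K (H.iter (H.genFrac ι) k) ⟨N - k, le_trans one_le_two hj.1, hj.2⟩
  have hX : f X = H.iter (H.genQuot P κ) k (N - k) := hf _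
  constructor
  · rintro _ ⟨u, rfl⟩
    have hloc := h.exists_step_mul_pow_mem hj (l := N + 1) ⟨by omega, le_rfl⟩
    rw [← alg_eq_lower, ← alg_eq_lower] at hloc
    obtain ⟨n, hn⟩ := hloc u u.2
    exact ⟨n, ⟨_, hn⟩, (hc u ⟨_, hn⟩ n rfl).symm⟩
  · rintro _ ⟨u, rfl⟩
    have hloc := h.exists_mul_pow_mem_step hj
    rw [← alg_eq_lower, ← alg_eq_lower] at hloc
    obtain ⟨n, hn⟩ := hloc u u.2
    refine ⟨n, ⟨_, hn⟩, ?_⟩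
    have := hc ⟨_, hn⟩ (u * X ^ n) 0 (by rw [pow_zero, mul_one]; rfl)
    rw [pow_zero, mul_one, map_mul, map_pow, hX] at this
    exact this

variable (w : Set (Set.Icc 1 N))

theorem sigIter_le_alg (m : ℕ) : H.sigIter P κ w m ≤ (H.algBar P κ (m + 2)).toSubmonoid := by
  cases m with
  | zero =>
    refine Submonoid.closure_le.2 ?_
    rintro _ ⟨i, -, rfl⟩
    exact Algebra.subset_adjoin (Set.mem_image_of_mem _ i.2)
  | succ m => exact inf_le_left

theorem sigIter_le (m : ℕ) : H.sigIter P κ w m ≤ H.sigIter P κ w 0 := by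
  induction m with
  | zero => exact le_rfl
  | succ m ih => exact inf_le_right.trans ih

/-- The step at `l` leaves the `l`-th entry alone, so this entry is final already with superscript
`(l + 1)`, just before it serves as denominator. -/
theorem barX_eq {j : ℕ} (hj : 2 ≤ j) {l : ℕ} (hl : j ≤ l + 1) :
    H.barX P κ j l = H.barX P κ 2 l := by
  have : N + 1 - 2 = (N + 1 - j) + (N + 1 - 2 - (N + 1 - j)) := by omega
  rw [barX, barX, seq, seq, this, H.iter_eq_of_le _ (by omega)]

theorem barX_mem_sigIter (m : ℕ) {l : Set.Icc 1 N} (hl : l ∉ w) (hm : m + 1 ≤ l) :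
    H.barX P κ 2 l ∈ H.sigIter P κ w m := by
  induction m with
  | zero => exact Submonoid.subset_closure ⟨l, hl, rfl⟩
  | succ m ih =>
    refine ⟨?_, ih (by omega)⟩
    rw [← H.barX_eq P (j := m + 3) (by omega) (by omega)]
    exact Algebra.subset_adjoin (Set.mem_image_of_mem _ l.2)

theorem rightFractions_sigIter (hι : Function.Injective ι) (hκ : Function.Injective κ)
    (hw : ∀ l : Set.Icc 1 N, H.barX P κ 2 l ≠ 0 → l ∉ w) {m : ℕ} (hm : m ≤ N + 1 - 2) :
    rightFractions (H.algBar P κ 2) (H.sigIter P κ w 0) =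
      rightFractions (H.algBar P κ (m + 2)) (H.sigIter P κ w m) := by
  induction m with
  | zero => rfl
  | succ m ih =>
    rw [ih (by omega)]
    let k := N - (m + 2)
    have hk : N - k = m + 2 := by omega
    have hk1 : N + 1 - (m + 2) = k + 1 := by omega
    have hk0 : N + 1 - (m + 1 + 2) = k := by omega
    let z := H.iter (H.genQuot P κ) k (N - k)
    have hle := H.sigIter_le_alg P (κ := κ) w m
    by_cases hz : z = 0
    -- A step at a zero entry changes neither the algebra nor, therefore, the denominator set.
    · have : H.algBar P κ (m + 1 + 2) = H.algBar P κ (m + 2) := by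
        rw [algBar, algBar, barX, barX, seq, seq, hk1, hk0, iter, H.step_of_eq_zero hz]
      rw [sigIter, show m + 3 = m + 1 + 2 from rfl, this, inf_eq_right.2 hle]
    · let l : Set.Icc 1 N := ⟨m + 2, by omega, by omega⟩
      have hzl : z = H.barX P κ (m + 1 + 2) l := by
        simp only [z, barX, seq, hk0, hk, l]
      have hz2 : z = H.barX P κ 2 l := by
        rw [hzl, H.barX_eq P (by omega) (show m + 1 + 2 ≤ m + 2 + 1 by omega)]
      obtain ⟨h1, h2⟩ := H.exists_mul_pow_mem_iter P hι hκ (k := k) (by omega) hz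
      refine rightFractions_eq hle hz ?_ ?_ ?_ ?_
      · rw [hz2]
        exact H.barX_mem_sigIter P w m (hw l (hz2 ▸ hz)) (show m + 1 ≤ m + 2 by omega)
      · rw [hzl]
        exact Algebra.subset_adjoin (Set.mem_image_of_mem _ l.2)
      · rw [algBar, algBar, barX, barX, seq, seq, hk1, show m + 3 = m + 1 + 2 from rfl, hk0]
        exact h1
      · rw [algBar, algBar, barX, barX, seq, seq, hk1, show m + 3 = m + 1 + 2 from rfl, hk0]
        exact h2

theorem exists_mul_comm_t (hι : Function.Injective ι) (i : Set.Icc 1 N) (b : H.B' ι P) :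
    ∃ b' : H.B' ι P, b * H.t ι P i = H.t ι P i * b' := by
  -- Here `m` is at most 2, so any two distinct indices satisfy the bound in `comm_all` and all the
  -- `T_i` skew-commute.
  obtain ⟨θ, h⟩ := H.exists_isStage hι (k := N + 1 - 2) (m := N + 1 - (N + 1 - 2)) (by omega)
    (by omega)
  obtain ⟨⟨a, ha⟩, rfl⟩ := quoMk_surjective (K := K) _ b
  induction ha using Algebra.adjoin_induction with
  | mem a ha =>
    obtain ⟨l, hl, rfl⟩ := ha
    by_cases hli : l = i
    · subst hli
      exact ⟨_, rfl⟩
    · have hne := h.comm_all hl i.2 hli (by have := hl.1; have := i.2.1; omega)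
      have hT : H.T ι ⟨l, hl⟩ * H.T ι i = H.lam l i • (H.T ι i * H.T ι ⟨l, hl⟩) :=
        Subtype.ext hne
      have hT' := congrArg (quoMk K (H.psi ι P)) hT
      rw [map_smul, map_mul, map_mul, ← mul_smul_comm] at hT'
      exact ⟨H.lam l i • quoMk K _ (H.T ι ⟨l, hl⟩), hT'⟩
  | algebraMap c =>
    refine ⟨algebraMap K _ c, ?_⟩
    rw [← Algebra.commutes]
    exact congrArg (· * H.t ι P i) ((quoMk K _).commutes c)
  | add a b ha hb h h' =>
    obtain ⟨a', h1⟩ := h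
    obtain ⟨b', h2⟩ := h'
    refine ⟨a' + b', ?_⟩
    rw [mul_add, ← h1, ← h2, ← add_mul, ← map_add]
    rfl
  | mul a b ha hb h h' =>
    obtain ⟨a', h1⟩ := h
    obtain ⟨b', h2⟩ := h'
    refine ⟨a' * b', ?_⟩
    rw [← mul_assoc, ← h1, mul_assoc, ← h2, ← mul_assoc, ← map_mul]
    rfl

theorem exists_mul_comm_Sig (hι : Function.Injective ι) {e : H.B' ι P} (he : e ∈ H.Sig ι w P) :
    ∀ b : H.B' ι P, ∃ b' : H.B' ι P, b * e = e * b' := by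
  induction he using Submonoid.closure_induction with
  | mem e he =>
    obtain ⟨i, -, rfl⟩ := he
    exact H.exists_mul_comm_t P hι i
  | one => exact fun b => ⟨b, by rw [mul_one, one_mul]⟩
  | mul e f _ _ he hf =>
    intro b
    obtain ⟨b', h1⟩ := he b
    obtain ⟨b'', h2⟩ := hf b'
    exact ⟨b'', by rw [← mul_assoc, h1, mul_assoc, h2, mul_assoc]⟩

end QuantumNilpotentAlgebra

/-! ### Operators with scalar powers, and the transfer of representations -/

theorem isUnit_of_pow_eq_smul_one {K : Type*} [Field K] {R : Type*} [Ring R] [Algebra K R] {a : R}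
    {ξ : K} (hξ : ξ ≠ 0) {l : ℕ} (hl : l ≠ 0) (h : a ^ l = ξ • (1 : R)) : IsUnit a := by
  rw [← isUnit_pow_iff hl, h, ← Algebra.algebraMap_eq_smul_one]
  exact hξ.isUnit.map _

/-- An operator with a scalar power preserves the same subspaces as its inverse. -/
theorem mem_of_apply_mem_of_pow_eq_smul_one {K : Type*} [Field K] {V : Type*} [AddCommGroup V]
    [Module K V] {a : Module.End K V} {ξ : K} (hξ : ξ ≠ 0) {l : ℕ} (hl : 1 < l)
    (h : a ^ l = ξ • (1 : Module.End K V)) (W : Submodule K V) (hW : ∀ v ∈ W, a v ∈ W) (v : V)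
    (hv : a v ∈ W) : v ∈ W := by
  have hpow : ∀ n, ∀ v ∈ W, (a ^ n) v ∈ W := by
    intro n
    induction n with
    | zero => exact fun v hv => hv
    | succ n ih =>
      intro v hv
      rw [pow_succ]
      exact ih _ (hW v hv)
  have h1 := hpow (l - 1) _ hv
  rw [← Module.End.mul_apply, ← pow_succ, Nat.sub_add_cancel hl.le, h] at h1
  have h2 := W.smul_mem ξ⁻¹ h1
  rwa [LinearMap.smul_apply, smul_smul, inv_mul_cancel₀ hξ, one_smul] at h2

/-- `B'` embeds in `Frac(B)`. -/
theorem QuantumNilpotentAlgebra.exists_embedding {K : Type*} [Field K] {N : ℕ} {A : Type*} [Ring A]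
    [Algebra K A] (H : QuantumNilpotentAlgebra K N A) {F : Type*} [DivisionRing F] [Algebra K F]
    {G : Type*} [DivisionRing G] [Algebra K G] {ι : A →ₐ[K] F} (P : TwoSidedIdeal A)
    {κ : Quo P →ₐ[K] G} (hι : Function.Injective ι) (hκ : Function.Injective κ) :
    ∃ γ : H.B' ι P →ₐ[K] G, Function.Injective γ ∧
      (∀ i : Set.Icc 1 N, γ (H.t ι P i) = H.barX P κ 2 i) ∧ γ.range = H.algBar P κ 2 := by
  obtain ⟨f, hf, hI⟩ : ∃ f : H.A' ι →ₐ[K] G,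
      (∀ i : Set.Icc 1 N, f (H.T ι i) = H.barX P κ 2 i) ∧ ∀ a, a ∈ H.psi ι P ↔ f a = 0 :=
    H.exists_hom_iter P hι hκ (k := N + 1 - 2) (by omega)
  obtain ⟨γ, hγ⟩ := exists_quo_lift (H.psi ι P) f fun a ha => (hI a).1 ha
  refine ⟨γ, ?_, fun i => (hγ _).trans (hf i), ?_⟩
  · rw [injective_iff_map_eq_zero]
    intro b hb
    obtain ⟨a, rfl⟩ := quoMk_surjective (K := K) _ b
    rw [hγ] at hb
    exact (quoMk_eq_zero _ _).2 ((hI a).2 hb)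
  · have hr : f.range = H.algBar P κ 2 := hom_range_eq_alg f hf
    rw [← hr]
    apply le_antisymm
    · rintro _ ⟨b, rfl⟩
      obtain ⟨a, rfl⟩ := quoMk_surjective (K := K) _ b
      exact ⟨a, (hγ a).symm⟩
    · rintro _ ⟨a, rfl⟩
      exact ⟨_, hγ a⟩

end DeletingDerivations

theorem proposition5p1 {K : Type*} [Field K] {N : ℕ} {A : Type*} [Ring A] [Algebra K A]
    (H : DeletingDerivations.QuantumNilpotentAlgebra K N A)
    -- `F = Frac(A)`
    {F : Type*} [DivisionRing F] [Algebra K F] (ι : A →ₐ[K] F)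
    (hF : DeletingDerivations.IsDivisionRingOfFractions ι)
    (w : Set (Set.Icc 1 N)) (P : TwoSidedIdeal A) (hP : H.CSpec ι w P)
    -- `G = Frac(B)`, where `B = A / P`
    {G : Type*} [DivisionRing G] [Algebra K G] (κ : DeletingDerivations.Quo P →ₐ[K] G)
    (hG : DeletingDerivations.IsDivisionRingOfFractions κ)
    {V : Type*} [AddCommGroup V] [Module K V]
    (φ' : H.B' ι P →ₐ[K] Module.End K V)
    (hirr : DeletingDerivations.IsIrreducibleRep φ')
    (hscal : ∀ e ∈ H.Sig ι w P, ∃ ξ : K, ξ ≠ 0 ∧ ∃ l : ℕ, 1 < l ∧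
      φ' e ^ l = ξ • (1 : Module.End K V)) :
    -- `γ` is the identification of `B'` with a subalgebra of `Frac(B)`
    ∃ γ : H.B' ι P →ₐ[K] G, Function.Injective γ ∧
      (∀ i : Set.Icc 1 N, γ (H.t ι P i) = H.barX P κ 2 i) ∧
      -- `B' Σ⁻¹ = B Γ⁻¹`
      {f : G | ∃ b' : H.B' ι P, ∃ e ∈ H.Sig ι w P, f = γ b' * (γ e)⁻¹} =
        {f : G | ∃ b : DeletingDerivations.Quo P, ∃ g ∈ H.Gam P κ w, f = κ b * (κ g)⁻¹} ∧
      (∀ b : DeletingDerivations.Quo P, ∃ b' : H.B' ι P, ∃ e ∈ H.Sig ι w P,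
        κ b = γ b' * (γ e)⁻¹) ∧
      ∃ φ : DeletingDerivations.Quo P →ₐ[K] Module.End K V,
        (∀ (b : DeletingDerivations.Quo P) (b' : H.B' ι P), ∀ e ∈ H.Sig ι w P,
          κ b = γ b' * (γ e)⁻¹ →
          ∀ (ξ : K) (l : ℕ), ξ ≠ 0 → 1 < l → φ' e ^ l = ξ • (1 : Module.End K V) →
            φ b = ξ⁻¹ • (φ' b' * φ' e ^ (l - 1))) ∧
        DeletingDerivations.IsIrreducibleRep φ ∧
        ∀ g ∈ H.Gam P κ w, ∃ ξ : K, ξ ≠ 0 ∧ ∃ l : ℕ, 1 < l ∧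
          φ g ^ l = ξ • (1 : Module.End K V) := by
  classical
  have hι := hF.1
  have hκ := hG.1
  have hV : Nontrivial V := hirr.1
  obtain ⟨γ, hinj, hγt, hrange⟩ := H.exists_embedding P hι hκ
  have hw : ∀ l : Set.Icc 1 N, H.barX P κ 2 l ≠ 0 → l ∉ w := by
    intro l hl hlw
    have h0 : H.t ι P l = 0 := (DeletingDerivations.quoMk_eq_zero _ _).2 ((hP.2 l).2 hlw)
    rw [← hγt, h0, map_zero] at hl
    exact hl rfl
  have hunit : ∀ e ∈ H.Sig ι w P, IsUnit (φ' e) := by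
    intro e he
    obtain ⟨ξ, hξ, l, hl, h⟩ := hscal e he
    exact DeletingDerivations.isUnit_of_pow_eq_smul_one hξ (by omega) h
  -- Zero is excluded from `Σ` because its elements act invertibly on a nonzero space.
  have hne : ∀ e ∈ H.Sig ι w P, γ e ≠ 0 := by
    intro e he h0
    have : e = 0 := hinj (h0.trans (map_zero γ).symm)
    have hu := hunit e he
    rw [this, map_zero] at hu
    exact not_isUnit_zero hu
  have hSig : (H.Sig ι w P).map γ = H.sigIter P κ w 0 := by
    rw [DeletingDerivations.QuantumNilpotentAlgebra.Sig, MonoidHom.map_mclosure,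
      DeletingDerivations.QuantumNilpotentAlgebra.sigIter, ← Set.image_comp]
    congr 1
    exact Set.image_congr fun i _ => hγt i
  -- With truncated subtraction the superscript is `N + 1`, or 2 when `N = 0`; in both cases no step
  -- has been made.
  have hκr : κ.range = H.algBar P κ (N + 1 - 2 + 2) := by
    have h0 : N + 1 - (N + 1 - 2 + 2) = 0 := by omega
    rw [DeletingDerivations.QuantumNilpotentAlgebra.algBar,
      DeletingDerivations.QuantumNilpotentAlgebra.barX,
      DeletingDerivations.QuantumNilpotentAlgebra.seq, h0]
    have htop : (κ.comp (DeletingDerivations.quoMk K P)).range = κ.range := by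
      apply le_antisymm
      · rintro _ ⟨a, rfl⟩
        exact ⟨_, rfl⟩
      · rintro _ ⟨b, rfl⟩
        obtain ⟨a, rfl⟩ := DeletingDerivations.quoMk_surjective (K := K) _ b
        exact ⟨a, rfl⟩
    rw [← htop, ← Algebra.map_top, ← H.adjoin_X_eq_top, AlgHom.map_adjoin, ← Set.image_comp]
    rfl
  have hfrac := H.rightFractions_sigIter P w hι hκ hw le_rfl
  have hleft : {f : G | ∃ b' : H.B' ι P, ∃ e ∈ H.Sig ι w P, f = γ b' * (γ e)⁻¹} =
      DeletingDerivations.rightFractions (H.algBar P κ 2) (H.sigIter P κ w 0) := by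
    rw [← hrange, ← hSig]
    ext f
    constructor
    · rintro ⟨b', e, he, rfl⟩
      exact ⟨_, ⟨b', rfl⟩, _, ⟨e, he, rfl⟩, rfl⟩
    · rintro ⟨_, ⟨b', rfl⟩, _, ⟨e, he, rfl⟩, rfl⟩
      exact ⟨b', e, he, rfl⟩
  have hright : {f : G | ∃ b : DeletingDerivations.Quo P, ∃ g ∈ H.Gam P κ w,
      f = κ b * (κ g)⁻¹} = DeletingDerivations.rightFractions (H.algBar P κ (N + 1 - 2 + 2))
        (H.sigIter P κ w (N + 1 - 2)) := by
    have hle := H.sigIter_le_alg P (κ := κ) w (N + 1 - 2)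
    rw [← hκr] at hle ⊢
    ext f
    constructor
    · rintro ⟨b, g, hg, rfl⟩
      exact ⟨_, ⟨b, rfl⟩, _, hg, rfl⟩
    · rintro ⟨_, ⟨b, rfl⟩, g', hg', rfl⟩
      obtain ⟨g, rfl⟩ := hle hg'
      exact ⟨b, g, hg', rfl⟩
  have hset := hleft.trans (hfrac.trans hright.symm)
  have hb : ∀ b : DeletingDerivations.Quo P, ∃ b' : H.B' ι P, ∃ e ∈ H.Sig ι w P,
      κ b = γ b' * (γ e)⁻¹ := by
    intro b
    have : κ b ∈ {f : G | ∃ b : DeletingDerivations.Quo P, ∃ g ∈ H.Gam P κ w,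
        f = κ b * (κ g)⁻¹} := ⟨b, 1, Submonoid.one_mem _, by simp⟩
    rwa [← hset] at this
  obtain ⟨h, hh⟩ := DeletingDerivations.exists_algHom_of_fractions γ hinj φ' (H.Sig ι w P)
    (fun b e he => by
      obtain ⟨b', hb'⟩ := H.exists_mul_comm_Sig P w hι he b
      exact ⟨b', e, he, hb'⟩)
    hunit κ.range
    (by
      rintro _ ⟨b, rfl⟩
      obtain ⟨b', e, he, hbe⟩ := hb b
      exact ⟨e, he, b', by
        rw [← inv_mul_cancel_right₀ (hne e he) (γ b'), ← hbe]
        rfl⟩)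
  let φ : DeletingDerivations.Quo P →ₐ[K] Module.End K V := h.comp κ.rangeRestrict
  have hφ : ∀ b b', ∀ e ∈ H.Sig ι w P, κ b * γ e = γ b' → φ b * φ' e = φ' b' :=
    fun b b' e he hbe => hh (κ.rangeRestrict b) b' e he hbe
  -- Under the identification `Γ` is a subset of `Σ`, on which `φ` and `φ'` agree. The scalar powers
  -- for `Γ` follow at once.
  have hGam : ∀ g ∈ H.Gam P κ w, ∃ e ∈ H.Sig ι w P, κ g = γ e ∧ φ g = φ' e := by
    intro g hg
    have h1 : κ g ∈ H.sigIter P κ w 0 := H.sigIter_le P w _ hg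
    rw [← hSig] at h1
    obtain ⟨e, he, hge⟩ := h1
    have hge' : κ g = γ e := hge.symm
    refine ⟨e, he, hge', ?_⟩
    have := hφ g e 1 (Submonoid.one_mem _) (by rw [map_one, mul_one, hge'])
    rwa [map_one, mul_one] at this
  refine ⟨γ, hinj, hγt, hset, hb, φ, ?_, ⟨hV, ?_⟩, ?_⟩
  · intro b b' e he hbe ξ l hξ hl hpow
    have h1 := hφ b b' e he (by rw [hbe, inv_mul_cancel_right₀ (hne e he)])
    -- The operator `ξ⁻¹ • φ' e ^ (l - 1)` inverts `φ' e`, so the formula holds for every choice of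
    -- data.
    rw [← h1, mul_assoc, ← pow_succ', Nat.sub_add_cancel hl.le, hpow, mul_smul_comm, mul_one,
      smul_smul, inv_mul_cancel₀ hξ, one_smul]
  · intro W hW
    refine hirr.2 W fun b' v hv => ?_
    -- Writing `b' = b g⁻¹` with `g ∈ Γ`, the action of `b'` on `φ' e u`, where `e` is the element
    -- of `Σ` equal to `g`, is that of `b` on `u`; and `u` lies in `W` since `φ' e` has a scalar
    -- power.
    have hmem : γ b' ∈ {f : G | ∃ b : DeletingDerivations.Quo P, ∃ g ∈ H.Gam P κ w,
        f = κ b * (κ g)⁻¹} := by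
      rw [← hset]
      exact ⟨b', 1, Submonoid.one_mem _, by simp⟩
    obtain ⟨b, g, hg, hbg⟩ := hmem
    obtain ⟨e, he, hge, hφg⟩ := hGam g hg
    obtain ⟨ξ, hξ, l, hl, hpow⟩ := hscal e he
    rw [hge] at hbg
    have h1 : φ b = φ' (b' * e) := by
      have := hφ b (b' * e) 1 (Submonoid.one_mem _) (by
        rw [map_one, mul_one, map_mul, hbg, inv_mul_cancel_right₀ (hne e he)])
      rwa [map_one, mul_one] at this
    have hWe : ∀ v ∈ W, φ' e v ∈ W := fun v hv => hφg ▸ hW g v hv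
    obtain ⟨u, rfl⟩ : ∃ u, φ' e u = v := by
      obtain ⟨a, ha⟩ := hunit e he
      refine ⟨(↑a⁻¹ : Module.End K V) v, ?_⟩
      rw [← ha, ← Module.End.mul_apply, Units.mul_inv, Module.End.one_apply]
    have hu := DeletingDerivations.mem_of_apply_mem_of_pow_eq_smul_one hξ hl hpow W hWe u hv
    have h2 := hW b u hu
    rwa [h1, map_mul, Module.End.mul_apply] at h2
  · intro g hg
    obtain ⟨e, he, -, hφg⟩ := hGam g hg
    rw [hφg]
    exact hscal e he
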